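/- Let $N\ge 1$, $D=N^2$, and consider the bipartite Hilbert space $\mathbb{C}^N\otimes\mathbb{C}^N$ of dimension $D$ with computational basis $|j\rangle=|a\rangle|b\rangle$, $1\le a,b\le N$. Consider the following Haar-random model. - $S_1\ge S_2\ge\dots\ge S_N\ge 0$ are distributed as the Schmidt coefficients of a Haar-random unit vector in $\mathbb{C}^N\otimes\mathbb{C}^N$ (that is, as the singular values of an $N\times N$ matrix with i.i.d. complex Gaussian entries divided by its Frobenius norm). - $|l_1\rangle,\dots,|l_N\rangle$ and $|r_1\rangle,\dots,|r_N\rangle$ are the columns of two Haar-random $N\times N$ unitary matrices. - The two unitary matrices and the tuple $(S_\alpha)$ are mutually independent. Let $$|\psi\rangle=\sum_{\alpha=1}^{N}S_\alpha|l_\alpha\rangle\otimes|r_\alpha\rangle,$$ and for a bond dimension $\chi\ge1$ let $|\tilde\psi\rangle$ be its optimal rank-$\chi$ Schmidt truncation, $$|\tilde\psi\rangle=\Big(\sum_{\alpha\le\chi}S_\alpha^2\Big)^{-1/2}\sum_{\alpha\le\chi}S_\alpha|l_\alpha\rangle\otimes|r_\alpha\rangle,$$ where the sums run over $\alpha\le\min(\chi,N)$.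 Let $p_j=|\langle j|\psi\rangle|^2$ and $\tilde p_j=|\langle j|\tilde\psi\rangle|^2$, let $F=|\langle\psi|\tilde\psi\rangle|^2$ be the fidelity (it equals $\sum_{\alpha\le\chi}S_\alpha^2$ almost surely), and let the linear XEB be $D\sum_j p_j\tilde p_j-1$. Then $\sum_j p_j\tilde p_j$ and $F$ are integrable, and there is an absolute constant $C$, independent of $D$ and $\chi$, such that for all $N\ge1$ and all $\chi\ge1$ $$\Big|\,D\,\mathbb{E}\Big[\sum_j p_j\tilde p_j\Big]-1-\mathbb{E}[F]\,\Big|\le\frac{C}{\sqrt D}.$$ Moreover, the same holds with only the Schmidt vectors averaged and $F$ not averaged: writing $\mathbb{E}_{l,r}$ for the expectation over the vectors $|l_\alpha\rangle,|r_\alpha\rangle$ with the singular values held fixed, $$\mathbb{E}_{S}\,\Big|\,\mathbb{E}_{l,r}\Big[D\sum_j p_j\tilde p_j-1-F\Big]\,\Big|\le\frac{C}{\sqrt D}.$$ Thus the linear XEB is an estimator of the fidelity of truncated-MPS simulations of Haar-random states whose bias is $O(1/\sqrt D)$, uniformly in $\chi$. -/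

import Mathlib

open MeasureTheory ProbabilityTheory

noncomputable section

namespace XEB

/-! ### Haar-random unitaries -/

/-- The Borel sigma-algebra of the unitary group `U(N)`. -/
instance unitaryMeasurableSpace (N : ℕ) :
    MeasurableSpace (Matrix.unitaryGroup (Fin N) ℂ) := borel _

instance unitaryBorelSpace (N : ℕ) : BorelSpace (Matrix.unitaryGroup (Fin N) ℂ) := ⟨rfl⟩

instance unitaryCompactSpace (N : ℕ) : CompactSpace (Matrix.unitaryGroup (Fin N) ℂ) := by
  refine isCompact_iff_compactSpace.mp ?_
  have hball : IsCompact
      (Set.univ.pi fun _ : Fin N => Set.univ.pi fun _ : Fin N => Metric.closedBall (0 : ℂ) 1) :=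
    isCompact_univ_pi fun _ => isCompact_univ_pi fun _ => isCompact_closedBall _ _
  refine hball.of_isClosed_subset ?_ ?_
  · have h : ((Matrix.unitaryGroup (Fin N) ℂ : Submonoid _) : Set (Matrix (Fin N) (Fin N) ℂ)) =
        {A | star A * A = 1} ∩ {A | A * star A = 1} := by
      ext A
      exact Unitary.mem_iff
    exact h ▸ ((isClosed_eq (by fun_prop) (by fun_prop)).inter
      (isClosed_eq (by fun_prop) (by fun_prop)))
  · intro A hA i _ j _
    simpa using entry_norm_bound_of_unitary hA i j

/-- The normalized Haar measure of the unitary group `U(N)`. -/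
def haarUnitary (N : ℕ) : Measure (Matrix.unitaryGroup (Fin N) ℂ) := Measure.haarMeasure ⊤

instance haarUnitary_isProbabilityMeasure (N : ℕ) : IsProbabilityMeasure (haarUnitary N) :=
  ⟨by
    have h := Measure.haarMeasure_self
      (K₀ := (⊤ : TopologicalSpace.PositiveCompacts (Matrix.unitaryGroup (Fin N) ℂ)))
    simpa [haarUnitary] using h⟩

/-! ### Bipartite states and Schmidt coefficients of a Haar-random state -/

/-- The bipartite Hilbert space `ℂ^N ⊗ ℂ^N`, of dimension `D = N ^ 2`, with its computational
basis indexed by pairs `j = (a, b)`. -/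
abbrev State (N : ℕ) : Type := EuclideanSpace ℂ (Fin N × Fin N)

/-- The Hilbert space dimension `D = N ^ 2`, as a real number. -/
def dim (N : ℕ) : ℝ := (N : ℝ) ^ 2

/-- A complex Gaussian variable: i.i.d. standard normal real and imaginary parts. -/
def complexGaussian : Measure ℂ :=
  ((gaussianReal 0 1).prod (gaussianReal 0 1)).map Complex.measurableEquivRealProd.symm

instance complexGaussian_isProbabilityMeasure : IsProbabilityMeasure complexGaussian :=
  Measure.isProbabilityMeasure_map Complex.measurableEquivRealProd.symm.measurable.aemeasurable

/-- The normalized vector with given coordinates. -/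
def normalizedState (N : ℕ) (g : Fin N × Fin N → ℂ) : State N :=
  ((‖(WithLp.toLp 2 g : State N)‖⁻¹ : ℝ) : ℂ) • (WithLp.toLp 2 g : State N)

theorem measurable_normalizedState (N : ℕ) : Measurable (normalizedState N) := by
  have h : Measurable fun g : Fin N × Fin N → ℂ => (WithLp.toLp 2 g : State N) :=
    (PiLp.continuous_toLp 2 _).measurable
  exact (Complex.measurable_ofReal.comp h.norm.inv).smul h

/-- The law of a Haar-random state: a vector with i.i.d. complex Gaussian amplitudes, normalized. -/
def haarState (N : ℕ) : Measure (State N) :=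
  (Measure.pi fun _ : Fin N × Fin N => complexGaussian).map (normalizedState N)

instance haarState_isProbabilityMeasure (N : ℕ) : IsProbabilityMeasure (haarState N) :=
  Measure.isProbabilityMeasure_map (measurable_normalizedState N).aemeasurable

/-- The Schmidt coefficients of a bipartite vector in decreasing order (indexed from `0`): the
singular values of its `N × N` matrix of amplitudes. -/
def schmidtCoeff {N : ℕ} (φ : State N) (α : Fin N) : ℝ :=
  (Matrix.toEuclideanLin (Matrix.of fun a b => φ (a, b))).singularValues α

/-! ### The random model -/

/-- A sample `(φ, U, V)`: the state `φ` supplies the Schmidt coefficients, and the unitaries `U`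
and `V` supply the left and right Schmidt vectors. -/
abbrev Sample (N : ℕ) : Type :=
  State N × Matrix.unitaryGroup (Fin N) ℂ × Matrix.unitaryGroup (Fin N) ℂ

/-- The Haar-random model: the Schmidt coefficients are those of a Haar-random state, and they are
independent of the left and right Schmidt vectors, which are the columns of two independent
Haar-random unitaries. -/
def model (N : ℕ) : Measure (Sample N) :=
  (haarState N).prod ((haarUnitary N).prod (haarUnitary N))

instance model_isProbabilityMeasure (N : ℕ) : IsProbabilityMeasure (model N) := by
  unfold model; infer_instance

/-- The singular value `S_α`. -/
def S {N : ℕ} (ω : Sample N) (α : Fin N) : ℝ := schmidtCoeff ω.1 α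

/-- The product vector `|ν_α⟩ = |l_α⟩ ⊗ |r_α⟩`, where `|l_α⟩` and `|r_α⟩` are the `α`-th columns
of the two unitaries. -/
def nu {N : ℕ} (ω : Sample N) (α : Fin N) : State N :=
  WithLp.toLp 2 fun j => ω.2.1.1 j.1 α * ω.2.2.1 j.2 α

/-- The ideal state `|ψ⟩ = ∑_α S_α |l_α⟩ ⊗ |r_α⟩`. -/
def psi {N : ℕ} (ω : Sample N) : State N := ∑ α, (S ω α : ℂ) • nu ω α

/-- The sum of the squares of the `χ` largest Schmidt coefficients. -/
def weight {N : ℕ} (χ : ℕ) (ω : Sample N) : ℝ :=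
  ∑ α with α.val < χ, S ω α ^ 2

/-- The optimal rank-`χ` approximation: the Schmidt decomposition of `|ψ⟩` truncated to the `χ`
largest Schmidt coefficients, and normalized. -/
def psiTrunc {N : ℕ} (χ : ℕ) (ω : Sample N) : State N :=
  ((Real.sqrt (weight χ ω))⁻¹ : ℂ) • ∑ α with α.val < χ, (S ω α : ℂ) • nu ω α

/-- The probability `|⟨j|φ⟩|²` of the outcome `j`. -/
def prob {N : ℕ} (φ : State N) (j : Fin N × Fin N) : ℝ := ‖φ j‖ ^ 2

/-- The overlap `∑_j p_j p̃_j` of the two output distributions. -/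
def overlap {N : ℕ} (χ : ℕ) (ω : Sample N) : ℝ :=
  ∑ j, prob (psi ω) j * prob (psiTrunc χ ω) j

/-- The fidelity `F = |⟨ψ|ψ̃⟩|²`. -/
def fidelity {N : ℕ} (χ : ℕ) (ω : Sample N) : ℝ :=
  ‖inner ℂ (psi ω) (psiTrunc χ ω)‖ ^ 2

/-- The linear XEB `D ∑_j p_j p̃_j - 1`. -/
def linearXEB {N : ℕ} (χ : ℕ) (ω : Sample N) : ℝ := dim N * overlap χ ω - 1

end XEB

end

/-! With the singular values fixed, each `p_j p̃_j` is a quartic polynomial in row `a` of one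
unitary times the same quartic in row `b` of the other. Independence turns its mean into a sum of
products of row moments, and `rowMoment_eq` evaluates these as two index pairings divided by
`N(N+1)`. The product of two such moments has three terms, so for coefficient vectors `x`, `y` the
mean is `(‖x‖²‖y‖² + ⟨x,y⟩² + 2∑ x_α² y_α²) / (N(N+1))²` (`integral_prob_mul_prob`).

For `x = S` and its normalized truncation `y`, with `‖S‖ = 1`, the first term gives 1 and the second
gives the fidelity `F`. Multiplying by `D` and summing over the `D` outcomes gives `r(1 + F + 2Q)`,
where `r = (N/(N+1))²` and `Q = ∑ S_α² y_α² ≤ S_1²`. The bias is therefore at most `4/N + 2 S_1²`,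
uniformly in `χ`.

It remains to show `E[S_1²] = O(1/N)` (`integral_sq_schmidtCoeff_zero_le`). For the unnormalized
Gaussian matrix, a net reduces the operator norm to exponentially many Gaussian linear forms,
controlled by exponential moments (`exists_dominating_ginibre`). The norm of order `N` is then
divided out, a Laplace transform handling the event that it is small. -/

noncomputable section

/-! ### Singular values: extremal bounds, perturbation, sum of squares. -/

namespace LinearMap

open Module InnerProductSpace

variable {𝕜 : Type*} [RCLike 𝕜]
  {E : Type*} [NormedAddCommGroup E] [InnerProductSpace 𝕜 E] [FiniteDimensional 𝕜 E]
  {F : Type*} [NormedAddCommGroup F] [InnerProductSpace 𝕜 F] [FiniteDimensional 𝕜 F]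

/-- An orthonormal basis of right singular vectors. -/
def singularBasis (T : E →ₗ[𝕜] F) {n : ℕ} (hn : finrank 𝕜 E = n) : OrthonormalBasis (Fin n) 𝕜 E :=
  T.isSymmetric_adjoint_comp_self.eigenvectorBasis hn

/-- The operator `T*T` is diagonal in this basis with eigenvalues `σ_i²`, and `‖Tv‖² = ⟨v, T*Tv⟩`.
-/
theorem norm_sq_apply_eq_sum_singularValues (T : E →ₗ[𝕜] F) {n : ℕ} (hn : finrank 𝕜 E = n) (v : E) :
    ‖T v‖ ^ 2 = ∑ i : Fin n, T.singularValues i ^ 2 * ‖(T.singularBasis hn).repr v i‖ ^ 2 := by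
  have h1 : ((‖T v‖ ^ 2 : ℝ) : 𝕜) = inner 𝕜 v ((adjoint T ∘ₗ T) v) := by
    rw [comp_apply, adjoint_inner_right, inner_self_eq_norm_sq_to_K]
    push_cast
    rfl
  rw [← (T.singularBasis hn).sum_inner_mul_inner] at h1
  have h2 : ∀ i, inner 𝕜 (T.singularBasis hn i) ((adjoint T ∘ₗ T) v) =
      ((T.singularValues i ^ 2 : ℝ) : 𝕜) * inner 𝕜 (T.singularBasis hn i) v := by
    intro i
    rw [← OrthonormalBasis.repr_apply_apply, ← OrthonormalBasis.repr_apply_apply,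
      T.sq_singularValues_fin hn]
    exact T.isSymmetric_adjoint_comp_self.eigenvectorBasis_apply_self_apply hn v i
  apply_fun (RCLike.re : 𝕜 → ℝ) at h1
  rw [RCLike.ofReal_re, map_sum] at h1
  rw [h1]
  refine Finset.sum_congr rfl fun i _ => ?_
  rw [h2, ← inner_conj_symm, OrthonormalBasis.repr_apply_apply]
  have h3 : ∀ z : 𝕜, ∀ r : ℝ, RCLike.re ((starRingEnd 𝕜) z * ((r : 𝕜) * z)) = r * ‖z‖ ^ 2 := by
    intro z r
    have : (starRingEnd 𝕜) z * ((r : 𝕜) * z) = ((r * ‖z‖ ^ 2 : ℝ) : 𝕜) := by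
      push_cast
      rw [← RCLike.conj_mul]
      ring
    rw [this, RCLike.ofReal_re]
  exact h3 _ _

/-- This and the next lemma are the two halves of the min-max principle: only coordinates with `σ_i
≤ σ_k` (respectively `σ_i ≥ σ_k`) survive. -/
theorem norm_apply_le_singularValues_mul (T : E →ₗ[𝕜] F) {n : ℕ} (hn : finrank 𝕜 E = n) (k : ℕ)
    (v : E) (hv : ∀ i : Fin n, i.val < k → (T.singularBasis hn).repr v i = 0) :
    ‖T v‖ ≤ T.singularValues k * ‖v‖ := by
  refine le_of_sq_le_sq ?_ (mul_nonneg (T.singularValues_nonneg k) (norm_nonneg _))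
  rw [T.norm_sq_apply_eq_sum_singularValues hn, mul_pow, ← (T.singularBasis hn).repr.norm_map v,
    EuclideanSpace.norm_sq_eq, Finset.mul_sum]
  refine Finset.sum_le_sum fun i _ => ?_
  by_cases hi : i.val < k
  · simp [hv i hi]
  · have := T.singularValues_antitone (not_lt.mp hi)
    have := T.singularValues_nonneg i
    gcongr

theorem singularValues_mul_le_norm_apply (T : E →ₗ[𝕜] F) {n : ℕ} (hn : finrank 𝕜 E = n) (k : ℕ)
    (v : E) (hv : ∀ i : Fin n, k < i.val → (T.singularBasis hn).repr v i = 0) :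
    T.singularValues k * ‖v‖ ≤ ‖T v‖ := by
  refine le_of_sq_le_sq ?_ (norm_nonneg _)
  rw [T.norm_sq_apply_eq_sum_singularValues hn, mul_pow, ← (T.singularBasis hn).repr.norm_map v,
    EuclideanSpace.norm_sq_eq, Finset.mul_sum]
  refine Finset.sum_le_sum fun i _ => ?_
  by_cases hi : k < i.val
  · simp [hv i hi]
  · have := T.singularValues_antitone (not_lt.mp hi)
    have := T.singularValues_nonneg k
    gcongr

theorem norm_apply_le_singularValues_zero (T : E →ₗ[𝕜] F) (v : E) :
    ‖T v‖ ≤ T.singularValues 0 * ‖v‖ :=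
  T.norm_apply_le_singularValues_mul rfl 0 v (by simp)

theorem exists_norm_apply_eq_singularValues_zero (T : E →ₗ[𝕜] F) (hE : 0 < finrank 𝕜 E) :
    ∃ v : E, ‖v‖ = 1 ∧ ‖T v‖ = T.singularValues 0 := by
  refine ⟨T.singularBasis rfl ⟨0, hE⟩, (T.singularBasis rfl).orthonormal.1 _, le_antisymm ?_ ?_⟩
  · simpa [(T.singularBasis rfl).orthonormal.1] using
      T.norm_apply_le_singularValues_zero (T.singularBasis rfl ⟨0, hE⟩)
  · have h := T.singularValues_mul_le_norm_apply rfl 0 (T.singularBasis rfl ⟨0, hE⟩) fun i hi => by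
      rw [OrthonormalBasis.repr_apply_apply]
      exact (T.singularBasis rfl).orthonormal.2 fun h => by simp [h] at hi
    simpa [(T.singularBasis rfl).orthonormal.1] using h

/-- Weyl's perturbation inequality for singular values. -/
theorem singularValues_le_add (T T' : E →ₗ[𝕜] F) {δ : ℝ} (hδ : ∀ v, ‖T v - T' v‖ ≤ δ * ‖v‖)
    {k : ℕ} (hk : k < finrank 𝕜 E) : T.singularValues k ≤ T'.singularValues k + δ := by
  set n := finrank 𝕜 E with hn
  -- The kernel imposes vanishing of the coordinates below `k` in the basis of `T'` and above `k` in
  -- the basis of `T`. These are only `n - 1` conditions, so a nonzero vector satisfies both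
  -- extremal bounds.
  let f : E →ₗ[𝕜] ({i : Fin n // i ≠ ⟨k, hk⟩} → 𝕜) := LinearMap.pi fun i =>
    if i.1.val < k then (EuclideanSpace.proj i.1).toLinearMap ∘ₗ
        (T'.singularBasis hn.symm).repr.toLinearEquiv.toLinearMap
    else (EuclideanSpace.proj i.1).toLinearMap ∘ₗ
        (T.singularBasis hn.symm).repr.toLinearEquiv.toLinearMap
  have hf : ker f ≠ ⊥ := by
    refine ker_ne_bot_of_finrank_lt ?_
    simp only [finrank_fintype_fun_eq_card, Fintype.card_subtype_compl, Fintype.card_fin,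
      Fintype.card_unique, ne_eq]
    omega
  obtain ⟨v, hv, hv0⟩ := Submodule.exists_mem_ne_zero_of_ne_bot hf
  have hfv : ∀ i, f v i = 0 := fun i => congrFun (LinearMap.mem_ker.mp hv) i
  have h1 : ‖T' v‖ ≤ T'.singularValues k * ‖v‖ := by
    refine T'.norm_apply_le_singularValues_mul hn.symm k v fun i hi => ?_
    have := hfv ⟨i, fun h => by simp [h] at hi⟩
    simpa [f, hi] using this
  have h2 : T.singularValues k * ‖v‖ ≤ ‖T v‖ := by
    refine T.singularValues_mul_le_norm_apply hn.symm k v fun i hi => ?_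
    have := hfv ⟨i, fun h => by simp [h] at hi⟩
    simpa [f, hi.le.not_gt] using this
  have h3 : ‖T v‖ ≤ ‖T' v‖ + ‖T v - T' v‖ := by
    simpa using norm_add_le (T' v) (T v - T' v)
  have hpos : 0 < ‖v‖ := norm_pos_iff.mpr hv0
  refine le_of_mul_le_mul_right ?_ hpos
  nlinarith [hδ v]

theorem sum_sq_singularValues (T : E →ₗ[𝕜] F) {n : ℕ} (hn : finrank 𝕜 E = n) {ι : Type*} [Fintype ι]
    (b : OrthonormalBasis ι 𝕜 E) :
    ∑ i : Fin n, T.singularValues i ^ 2 = ∑ i, ‖T (b i)‖ ^ 2 := by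
  simp_rw [T.norm_sq_apply_eq_sum_singularValues hn (b _)]
  rw [Finset.sum_comm]
  refine Finset.sum_congr rfl fun i _ => ?_
  rw [← Finset.mul_sum]
  have : ∑ x, ‖(T.singularBasis hn).repr (b x) i‖ ^ 2 = 1 := by
    simp_rw [OrthonormalBasis.repr_apply_apply]
    rw [b.sum_sq_norm_inner_left, (T.singularBasis hn).orthonormal.1, one_pow]
  rw [this, mul_one]

end LinearMap

/-! ### Schmidt coefficients as singular values of the amplitude matrix. -/

namespace XEB

/-- The linear map whose matrix is the matrix of amplitudes of a bipartite vector. -/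
def amplitudeMap {N : ℕ} (φ : State N) : EuclideanSpace ℂ (Fin N) →ₗ[ℂ] EuclideanSpace ℂ (Fin N) :=
  Matrix.toEuclideanLin (Matrix.of fun a b => φ (a, b))

theorem amplitudeMap_apply {N : ℕ} (φ : State N) (v : EuclideanSpace ℂ (Fin N)) (a : Fin N) :
    amplitudeMap φ v a = ∑ b, φ (a, b) * v b := by
  simp [amplitudeMap, Matrix.toLpLin_apply, Matrix.mulVec, dotProduct]

theorem schmidtCoeff_eq {N : ℕ} (φ : State N) (α : Fin N) :
    schmidtCoeff φ α = (amplitudeMap φ).singularValues α := rfl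

theorem amplitudeMap_sub {N : ℕ} (φ φ' : State N) (v : EuclideanSpace ℂ (Fin N)) :
    amplitudeMap φ v - amplitudeMap φ' v = amplitudeMap (φ - φ') v := by
  ext a
  simp [amplitudeMap_apply, sub_mul]

theorem amplitudeMap_smul {N : ℕ} (c : ℂ) (φ : State N) (v : EuclideanSpace ℂ (Fin N)) :
    amplitudeMap (c • φ) v = c • amplitudeMap φ v := by
  ext a
  simp [amplitudeMap_apply, Finset.mul_sum, mul_assoc]

theorem sum_sq_schmidtCoeff {N : ℕ} (φ : State N) : ∑ α, schmidtCoeff φ α ^ 2 = ‖φ‖ ^ 2 := by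
  simp_rw [schmidtCoeff_eq]
  rw [(amplitudeMap φ).sum_sq_singularValues (by simp) (EuclideanSpace.basisFun (Fin N) ℂ),
    EuclideanSpace.norm_sq_eq, Fintype.sum_prod_type_right]
  refine Finset.sum_congr rfl fun b _ => ?_
  rw [EuclideanSpace.norm_sq_eq]
  simp [amplitudeMap_apply]

theorem schmidtCoeff_nonneg {N : ℕ} (φ : State N) (α : Fin N) : 0 ≤ schmidtCoeff φ α :=
  LinearMap.singularValues_nonneg _ _

theorem schmidtCoeff_antitone {N : ℕ} (φ : State N) : Antitone (schmidtCoeff φ) :=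
  fun _ _ h => LinearMap.singularValues_antitone _ h

theorem schmidtCoeff_le_norm {N : ℕ} (φ : State N) (α : Fin N) : schmidtCoeff φ α ≤ ‖φ‖ := by
  refine le_of_sq_le_sq ?_ (norm_nonneg _)
  rw [← sum_sq_schmidtCoeff]
  exact Finset.single_le_sum (f := fun α => schmidtCoeff φ α ^ 2) (fun _ _ => sq_nonneg _)
    (Finset.mem_univ α)

theorem singularValues_zero_le_norm {N : ℕ} (φ : State N) :
    (amplitudeMap φ).singularValues 0 ≤ ‖φ‖ := by
  rcases Nat.eq_zero_or_pos N with rfl | hN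
  · rw [LinearMap.singularValues_of_finrank_le _ (by simp)]
    exact norm_nonneg _
  · exact schmidtCoeff_le_norm φ ⟨0, hN⟩

theorem norm_amplitudeMap_le {N : ℕ} (φ : State N) (v : EuclideanSpace ℂ (Fin N)) :
    ‖amplitudeMap φ v‖ ≤ ‖φ‖ * ‖v‖ :=
  ((amplitudeMap φ).norm_apply_le_singularValues_zero v).trans
    (mul_le_mul_of_nonneg_right (singularValues_zero_le_norm φ) (norm_nonneg v))

theorem schmidtCoeff_le_add {N : ℕ} (φ φ' : State N) (α : Fin N) :
    schmidtCoeff φ α ≤ schmidtCoeff φ' α + ‖φ - φ'‖ :=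
  LinearMap.singularValues_le_add (amplitudeMap φ) (amplitudeMap φ')
    (fun v => by rw [amplitudeMap_sub]; exact norm_amplitudeMap_le _ v) (by simp)

/-- Weyl's inequality makes each coefficient 1-Lipschitz; this is the source of all measurability of
the singular values. -/
theorem continuous_schmidtCoeff {N : ℕ} (α : Fin N) :
    Continuous fun φ : State N => schmidtCoeff φ α := by
  refine (LipschitzWith.of_dist_le_mul (K := 1) fun φ φ' => ?_).continuous
  rw [NNReal.coe_one, one_mul, Real.dist_eq, dist_eq_norm, abs_le]
  have h1 := schmidtCoeff_le_add φ φ' α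
  have h2 := schmidtCoeff_le_add φ' φ α
  rw [norm_sub_rev] at h2
  constructor <;> linarith

end XEB

/-! ### Nets and discretization of the largest singular value. -/

/-- A maximal `1`-separated subset of the ball of radius `2` is a `1`-net of that ball. -/
theorem exists_finset_net (E : Type*) [NormedAddCommGroup E] [NormedSpace ℝ E]
    [FiniteDimensional ℝ E] :
    ∃ T : Finset E, T.card ≤ 5 ^ Module.finrank ℝ E ∧ (∀ c ∈ T, ‖c‖ ≤ 2) ∧
      ∀ v : E, ‖v‖ ≤ 2 → ∃ c ∈ T, ‖v - c‖ ≤ 1 := by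
  classical
  let P : Finset E → Prop := fun s =>
    (∀ c ∈ s, ‖c‖ ≤ 2) ∧ ∀ c ∈ s, ∀ d ∈ s, c ≠ d → 1 ≤ ‖c - d‖
  -- Volume packing: disjoint balls of radius 1/2 inside a ball of radius 5/2. The bound also
  -- guarantees that a separated set of maximal cardinality exists.
  have hP : ∀ s, P s → s.card ≤ 5 ^ Module.finrank ℝ E := fun s hs =>
    Besicovitch.card_le_of_separated s hs.1 hs.2
  let Q : ℕ → Prop := fun n => ∃ s, P s ∧ s.card = n
  obtain ⟨T, hT, hcard⟩ : Q (Nat.findGreatest Q (5 ^ Module.finrank ℝ E)) :=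
    Nat.findGreatest_spec (Nat.zero_le _) ⟨∅, by simp [P], rfl⟩
  refine ⟨T, hP T hT, hT.1, fun v hv => ?_⟩
  by_contra! hcon
  have hvT : v ∉ T := fun h => by simpa using (hcon v h).trans_le' zero_le_one
  have hins : P (insert v T) := by
    refine ⟨fun c hc => ?_, fun c hc d hd hcd => ?_⟩
    · rcases Finset.mem_insert.mp hc with rfl | hc
      exacts [hv, hT.1 c hc]
    · rcases Finset.mem_insert.mp hc with hc | hc <;> rcases Finset.mem_insert.mp hd with hd | hd
      · exact absurd (hc.trans hd.symm) hcd
      · rw [hc]; exact (hcon d hd).le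
      · rw [norm_sub_rev, hd]; exact (hcon c hc).le
      · exact hT.2 c hc d hd hcd
  have := Nat.le_findGreatest (P := Q) (hP _ hins) ⟨_, hins, rfl⟩
  rw [Finset.card_insert_of_notMem hvT, ← hcard] at this
  omega

namespace LinearMap

/-- Radius 2 with mesh 1 makes the discretization lossless. For a top unit vector `v`, `‖A(2v)‖ =
2σ`, and moving from `2v` to the net costs at most `σ`. The same trick in the target, applied to the
vector of norm 2 along `A y`, leaves at least `‖A y‖`. -/
theorem exists_singularValues_zero_le_re_inner {E F : Type*} [NormedAddCommGroup E]
    [InnerProductSpace ℂ E] [FiniteDimensional ℂ E] [NormedAddCommGroup F]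
    [InnerProductSpace ℂ F] [FiniteDimensional ℂ F] (A : E →ₗ[ℂ] F)
    (hE : 0 < Module.finrank ℂ E) {T : Set E} {T' : Set F}
    (hT : ∀ v : E, ‖v‖ ≤ 2 → ∃ c ∈ T, ‖v - c‖ ≤ 1)
    (hT' : ∀ v : F, ‖v‖ ≤ 2 → ∃ c ∈ T', ‖v - c‖ ≤ 1) :
    ∃ x ∈ T', ∃ y ∈ T, A.singularValues 0 ≤ (inner ℂ x (A y)).re := by
  obtain ⟨v, hv, hAv⟩ := A.exists_norm_apply_eq_singularValues_zero hE
  obtain ⟨y, hy, hvy⟩ := hT ((2 : ℂ) • v) (by simp [norm_smul, hv])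
  have h1 : A.singularValues 0 ≤ ‖A y‖ := by
    have h2 := A.norm_apply_le_singularValues_zero ((2 : ℂ) • v - y)
    have h3 : ‖A ((2 : ℂ) • v)‖ = 2 * A.singularValues 0 := by
      rw [map_smul, norm_smul, hAv]; simp
    have h4 := norm_sub_norm_le (A ((2 : ℂ) • v)) (A y)
    rw [← map_sub, h3] at h4
    nlinarith [A.singularValues_nonneg 0]
  rcases eq_or_ne (A y) 0 with h0 | h0
  · obtain ⟨x, hx, -⟩ := hT' 0 (by simp)
    exact ⟨x, hx, y, hy, by rw [h0] at h1 ⊢; simpa using h1⟩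
  have hpos : 0 < ‖A y‖ := norm_pos_iff.mpr h0
  set u : F := ((2 * ‖A y‖⁻¹ : ℝ) : ℂ) • A y with hu
  have hu2 : ‖u‖ = 2 := by
    rw [hu, norm_smul, Complex.norm_real, Real.norm_of_nonneg (by positivity)]
    field_simp
  obtain ⟨x, hx, hux⟩ := hT' u hu2.le
  refine ⟨x, hx, y, hy, h1.trans ?_⟩
  have h5 : (inner ℂ u (A y)).re = 2 * ‖A y‖ := by
    rw [hu, inner_smul_left, inner_self_eq_norm_sq_to_K, Complex.conj_ofReal]
    have : ((2 * ‖A y‖⁻¹ : ℝ) : ℂ) * (‖A y‖ : ℂ) ^ 2 = ((2 * ‖A y‖ : ℝ) : ℂ) := by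
      push_cast
      have : (‖A y‖ : ℂ) ≠ 0 := by exact_mod_cast hpos.ne'
      field_simp
    exact (congrArg Complex.re this).trans (Complex.ofReal_re _)
  have h6 : (inner ℂ (u - x) (A y)).re ≤ ‖A y‖ :=
    ((Complex.re_le_norm _).trans (norm_inner_le_norm _ _)).trans
      (mul_le_of_le_one_left hpos.le hux)
  rw [inner_sub_left, Complex.sub_re, h5] at h6
  linarith

end LinearMap

namespace XEB

/-! ### Exponential moments of complex Gaussian variables -/

theorem integral_exp_mul_gaussianReal (t : ℝ) :
    ∫ x, Real.exp (t * x) ∂(gaussianReal 0 1) = Real.exp (t ^ 2 / 2) := by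
  have := congrFun (mgf_id_gaussianReal (μ := 0) (v := 1)) t
  simpa [mgf] using this

theorem integral_exp_neg_sq_gaussianReal :
    ∫ x, Real.exp (-x ^ 2) ∂(gaussianReal 0 1) = (Real.sqrt 3)⁻¹ := by
  rw [integral_gaussianReal_eq_integral_smul one_ne_zero]
  have h : ∀ x : ℝ, gaussianPDFReal 0 1 x • Real.exp (-x ^ 2) =
      (Real.sqrt (2 * Real.pi))⁻¹ * Real.exp (-(3 / 2) * x ^ 2) := by
    intro x
    rw [gaussianPDFReal_def, smul_eq_mul, mul_assoc, ← Real.exp_add]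
    simp only [NNReal.coe_one, mul_one, sub_zero]
    congr 2
    ring
  simp_rw [h]
  rw [integral_const_mul, integral_gaussian, ← Real.sqrt_inv, ← Real.sqrt_inv,
    ← Real.sqrt_mul (by positivity)]
  congr 1
  field_simp

theorem exp_re_mul_complexGaussian (c : ℂ) :
    Integrable (fun z : ℂ => Real.exp (c * z).re) complexGaussian ∧
      ∫ z, Real.exp (c * z).re ∂complexGaussian = Real.exp (‖c‖ ^ 2 / 2) := by
  have h : (fun p : ℝ × ℝ => Real.exp (c * Complex.measurableEquivRealProd.symm p).re) =
      fun p => Real.exp (c.re * p.1) * Real.exp (-c.im * p.2) := by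
    ext p
    rw [← Real.exp_add, Complex.mul_re, Complex.measurableEquivRealProd_symm_apply]
    ring_nf
  constructor
  · rw [complexGaussian, integrable_map_equiv, Function.comp_def, h]
    exact (integrable_exp_mul_gaussianReal _).mul_prod (integrable_exp_mul_gaussianReal _)
  · rw [complexGaussian, integral_map_equiv, h,
      integral_prod_mul (fun x => Real.exp (c.re * x)) (fun y => Real.exp (-c.im * y)),
      integral_exp_mul_gaussianReal, integral_exp_mul_gaussianReal, ← Real.exp_add,
      ← Complex.normSq_eq_norm_sq, Complex.normSq_apply]
    ring_nf

theorem exp_neg_norm_sq_complexGaussian :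
    Integrable (fun z : ℂ => Real.exp (-‖z‖ ^ 2)) complexGaussian ∧
      ∫ z, Real.exp (-‖z‖ ^ 2) ∂complexGaussian = 1 / 3 := by
  have h : (fun p : ℝ × ℝ => Real.exp (-‖Complex.measurableEquivRealProd.symm p‖ ^ 2)) =
      fun p => Real.exp (-p.1 ^ 2) * Real.exp (-p.2 ^ 2) := by
    ext p
    rw [← Real.exp_add, ← Complex.normSq_eq_norm_sq, Complex.normSq_apply,
      Complex.measurableEquivRealProd_symm_apply]
    ring_nf
  constructor
  · refine Integrable.of_bound (C := 1) (by fun_prop) (Filter.Eventually.of_forall fun z => ?_)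
    rw [Real.norm_of_nonneg (Real.exp_nonneg _), Real.exp_le_one_iff]
    simp
  · rw [complexGaussian, integral_map_equiv, h,
      integral_prod_mul (fun x : ℝ => Real.exp (-x ^ 2)) (fun y => Real.exp (-y ^ 2)),
      integral_exp_neg_sq_gaussianReal, ← mul_inv, Real.mul_self_sqrt (by norm_num), one_div]

/-- The law of a family of `N × N` independent complex Gaussian amplitudes. -/
def ginibre (N : ℕ) : Measure (Fin N × Fin N → ℂ) := Measure.pi fun _ => complexGaussian

instance ginibre_isProbabilityMeasure (N : ℕ) : IsProbabilityMeasure (ginibre N) := by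
  unfold ginibre; infer_instance

theorem re_inner_amplitudeMap {N : ℕ} (φ : State N) (x y : EuclideanSpace ℂ (Fin N)) :
    (inner ℂ x (amplitudeMap φ y)).re =
      ∑ j : Fin N × Fin N, (starRingEnd ℂ (x j.1) * y j.2 * φ j).re := by
  rw [PiLp.inner_apply, ← Complex.re_sum, Fintype.sum_prod_type]
  congr 1
  refine Finset.sum_congr rfl fun a _ => ?_
  rw [amplitudeMap_apply, RCLike.inner_apply, Finset.sum_mul]
  exact Finset.sum_congr rfl fun b _ => by ring

theorem integrable_prod_exp_re_mul_ginibre {N : ℕ} (c : Fin N × Fin N → ℂ) :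
    Integrable (fun g => ∏ j, Real.exp (c j * g j).re) (ginibre N) ∧
      ∫ g, ∏ j, Real.exp (c j * g j).re ∂(ginibre N) = Real.exp ((∑ j, ‖c j‖ ^ 2) / 2) := by
  refine ⟨Integrable.fintype_prod (f := fun j z => Real.exp (c j * z).re)
    fun j => (exp_re_mul_complexGaussian _).1, ?_⟩
  rw [ginibre, integral_fintype_prod_eq_prod (fun (j : Fin N × Fin N) z => Real.exp (c j * z).re)]
  simp_rw [(exp_re_mul_complexGaussian _).2]
  rw [← Real.exp_sum, ← Finset.sum_div]

theorem exp_re_inner_amplitudeMap_ginibre {N : ℕ} (t : ℝ) (x y : EuclideanSpace ℂ (Fin N)) :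
    Integrable (fun g => Real.exp (t * (inner ℂ x (amplitudeMap (WithLp.toLp 2 g) y)).re))
        (ginibre N) ∧
      ∫ g, Real.exp (t * (inner ℂ x (amplitudeMap (WithLp.toLp 2 g) y)).re) ∂(ginibre N) =
        Real.exp (t ^ 2 * ‖x‖ ^ 2 * ‖y‖ ^ 2 / 2) := by
  set c : Fin N × Fin N → ℂ := fun j => (t : ℂ) * (starRingEnd ℂ (x j.1) * y j.2) with hc
  have h : (fun g : Fin N × Fin N → ℂ =>
      Real.exp (t * (inner ℂ x (amplitudeMap (WithLp.toLp 2 g) y)).re)) =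
      fun g => ∏ j, Real.exp (c j * g j).re := by
    ext g
    rw [re_inner_amplitudeMap, Finset.mul_sum, Real.exp_sum]
    refine Finset.prod_congr rfl fun j _ => ?_
    rw [hc, ← Complex.re_ofReal_mul]
    ring_nf
  rw [h, (integrable_prod_exp_re_mul_ginibre c).2]
  refine ⟨(integrable_prod_exp_re_mul_ginibre c).1, ?_⟩
  rw [EuclideanSpace.norm_sq_eq, EuclideanSpace.norm_sq_eq,
    mul_assoc, Finset.sum_mul_sum, Fintype.sum_prod_type, Finset.mul_sum]
  congr 2
  refine Finset.sum_congr rfl fun a _ => ?_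
  rw [Finset.mul_sum]
  refine Finset.sum_congr rfl fun b _ => ?_
  simp [hc, mul_pow]

/-- Used as an exponential Markov bound for the event that the Gaussian vector has small norm. -/
theorem exp_neg_norm_sq_ginibre (N : ℕ) :
    Integrable (fun g => Real.exp (-‖(WithLp.toLp 2 g : State N)‖ ^ 2)) (ginibre N) ∧
      ∫ g, Real.exp (-‖(WithLp.toLp 2 g : State N)‖ ^ 2) ∂(ginibre N) = (1 / 3) ^ N ^ 2 := by
  have h : (fun g : Fin N × Fin N → ℂ => Real.exp (-‖(WithLp.toLp 2 g : State N)‖ ^ 2)) =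
      fun g => ∏ j, Real.exp (-‖g j‖ ^ 2) := by
    ext g
    rw [EuclideanSpace.norm_sq_eq, ← Finset.sum_neg_distrib, Real.exp_sum]
  rw [h]
  refine ⟨Integrable.fintype_prod (f := fun _ z => Real.exp (-‖z‖ ^ 2))
    fun j => exp_neg_norm_sq_complexGaussian.1, ?_⟩
  rw [ginibre, integral_fintype_prod_eq_prod (fun (j : Fin N × Fin N) z => Real.exp (-‖z‖ ^ 2))]
  simp_rw [exp_neg_norm_sq_complexGaussian.2]
  simp [sq]

/-! ### The largest singular value of a Gaussian matrix -/

/-- Passes from exponential to second moments without integrating tails. With `u = √n s - K n`,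
either `u ≤ 0` and `s ≤ K√n`, or `n s² = (u + K n)² ≤ 2u² + 2K²n²` with `u² ≤ 2 exp u`. -/
theorem sq_le_add_exp {s K n : ℝ} (hK : 0 ≤ K) (hn : 0 < n) (hs : 0 ≤ s) :
    s ^ 2 ≤ 2 * K ^ 2 * n + 4 / n * Real.exp (Real.sqrt n * s - K * n) := by
  have hr : 0 < Real.sqrt n := Real.sqrt_pos.mpr hn
  have hrr : Real.sqrt n ^ 2 = n := Real.sq_sqrt hn.le
  have hexp := Real.exp_nonneg (Real.sqrt n * s - K * n)
  rcases le_total (Real.sqrt n * s - K * n) 0 with h | h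
  · have h1 : s ≤ K * Real.sqrt n := by
      refine le_of_mul_le_mul_left ?_ hr
      nlinarith
    have h2 : s ^ 2 ≤ (K * Real.sqrt n) ^ 2 := by gcongr
    rw [mul_pow, hrr] at h2
    have : 0 ≤ 4 / n * Real.exp (Real.sqrt n * s - K * n) := by positivity
    nlinarith [mul_nonneg (sq_nonneg K) hn.le]
  · have h1 := Real.quadratic_le_exp_of_nonneg h
    set u := Real.sqrt n * s - K * n with hu
    have h2 : n * s ^ 2 = (u + K * n) ^ 2 := by
      rw [hu, sub_add_cancel, mul_pow, hrr]
    have h3 : n * s ^ 2 ≤ n * (2 * K ^ 2 * n + 4 / n * Real.exp u) := by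
      have : n * (2 * K ^ 2 * n + 4 / n * Real.exp u) = 2 * (K * n) ^ 2 + 4 * Real.exp u := by
        field_simp
      rw [this, h2]
      nlinarith [sq_nonneg (u - K * n)]
    exact le_of_mul_le_mul_left h3 hn

/-- A union bound in exponential form: the maximum over pairs of net points is replaced by the sum
of the exponentials, whose integrals are explicit. -/
theorem exists_dominating_ginibre {N : ℕ} (hN : 0 < N) :
    ∃ B : (Fin N × Fin N → ℂ) → ℝ, Integrable B (ginibre N) ∧ (∫ g, B g ∂(ginibre N) ≤ 454 * N) ∧
      ∀ g, schmidtCoeff (WithLp.toLp 2 g : State N) ⟨0, hN⟩ ^ 2 ≤ B g := by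
  obtain ⟨T, hcard, hT2, hnet⟩ := exists_finset_net (EuclideanSpace ℂ (Fin N))
  have hN' : (0 : ℝ) < N := by exact_mod_cast hN
  have hN1 : (1 : ℝ) ≤ N := by exact_mod_cast hN
  have hrank : Module.finrank ℝ (EuclideanSpace ℂ (Fin N)) = 2 * N := by
    rw [finrank_real_of_complex, finrank_euclideanSpace, Fintype.card_fin]
  rw [hrank] at hcard
  let e : EuclideanSpace ℂ (Fin N) × EuclideanSpace ℂ (Fin N) → (Fin N × Fin N → ℂ) → ℝ :=
    fun p g => Real.exp (Real.sqrt N * (inner ℂ p.1 (amplitudeMap (WithLp.toLp 2 g) p.2)).re)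
  have he : ∀ p, Integrable (e p) (ginibre N) := fun p =>
    (exp_re_inner_amplitudeMap_ginibre _ _ _).1
  have hint : ∀ p ∈ T ×ˢ T, ∫ g, e p g ∂(ginibre N) ≤ Real.exp (8 * N) := by
    intro p hp
    obtain ⟨h1, h2⟩ := Finset.mem_product.mp hp
    rw [(exp_re_inner_amplitudeMap_ginibre _ _ _).2, Real.sq_sqrt hN'.le, Real.exp_le_exp]
    have h3 : ‖p.1‖ ^ 2 ≤ 2 ^ 2 := by gcongr; exact hT2 _ h1
    have h4 : ‖p.2‖ ^ 2 ≤ 2 ^ 2 := by gcongr; exact hT2 _ h2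
    have h5 : ‖p.1‖ ^ 2 * ‖p.2‖ ^ 2 ≤ 2 ^ 2 * 2 ^ 2 := by gcongr
    nlinarith
  -- The rate 15 is 8 + 7: each exponential moment is at most `exp(8N)` since net points have norm
  -- at most 2, and there are at most `625^N ≤ exp(7N)` pairs. The total is `450N + 4 ≤ 454N`.
  refine ⟨fun g => 2 * 15 ^ 2 * N + 4 / N * (Real.exp (-(15 * N)) * ∑ p ∈ T ×ˢ T, e p g),
    ?_, ?_, fun g => ?_⟩
  · exact (integrable_const _).add
      (((integrable_finsetSum _ fun p _ => he p).const_mul _).const_mul _)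
  · rw [integral_add (integrable_const _)
      (((integrable_finsetSum _ fun p _ => he p).const_mul _).const_mul _),
      integral_const, integral_const_mul, integral_const_mul, integral_finsetSum _ fun p _ => he p]
    have hsum : ∑ p ∈ T ×ˢ T, ∫ g, e p g ∂(ginibre N) ≤ Real.exp (15 * N) := by
      refine (Finset.sum_le_card_nsmul _ _ _ hint).trans ?_
      rw [nsmul_eq_mul, Finset.card_product]
      have h1 : ((T.card * T.card : ℕ) : ℝ) ≤ Real.exp (7 * N) := by
        have h2 : ((T.card * T.card : ℕ) : ℝ) ≤ 625 ^ N := by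
          calc ((T.card * T.card : ℕ) : ℝ) ≤ ((5 ^ (2 * N) * 5 ^ (2 * N) : ℕ) : ℝ) := by
                exact_mod_cast Nat.mul_le_mul hcard hcard
            _ = 625 ^ N := by
                push_cast
                rw [← mul_pow, pow_mul]
                norm_num
        refine h2.trans ?_
        rw [mul_comm, Real.exp_nat_mul]
        refine pow_le_pow_left₀ (by norm_num) ?_ _
        have h3 : Real.exp 7 = Real.exp 1 ^ 7 := by rw [← Real.exp_nat_mul]; norm_num
        rw [h3]
        calc (625 : ℝ) ≤ 2.7 ^ 7 := by norm_num
          _ ≤ Real.exp 1 ^ 7 := by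
            gcongr
            exact le_trans (by norm_num) Real.exp_one_gt_d9.le
      calc _ ≤ Real.exp (7 * N) * Real.exp (8 * N) := by gcongr
        _ = Real.exp (15 * N) := by rw [← Real.exp_add]; ring_nf
    have h6 : Real.exp (-(15 * N)) * ∑ p ∈ T ×ˢ T, ∫ g, e p g ∂(ginibre N) ≤ 1 := by
      calc _ ≤ Real.exp (-(15 * N)) * Real.exp (15 * N) := by gcongr
        _ = 1 := by rw [← Real.exp_add]; simp
    have h7 : 4 / (N : ℝ) * (Real.exp (-(15 * N)) * ∑ p ∈ T ×ˢ T, ∫ g, e p g ∂(ginibre N)) ≤ 4 := by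
      calc _ ≤ 4 / (N : ℝ) * 1 := by gcongr
        _ ≤ 4 := by rw [mul_one]; exact div_le_self (by norm_num) hN1
    rw [probReal_univ, one_smul]
    linarith
  · have hs := sq_le_add_exp (K := 15) (by norm_num) hN'
      (schmidtCoeff_nonneg (WithLp.toLp 2 g : State N) ⟨0, hN⟩)
    refine hs.trans ?_
    obtain ⟨x, hx, y, hy, hxy⟩ := (amplitudeMap (WithLp.toLp 2 g : State N)).exists_singularValues_zero_le_re_inner
      (by simpa using hN) (T := T) (T' := T) hnet hnet
    have hle : e (x, y) g ≤ ∑ p ∈ T ×ˢ T, e p g :=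
      Finset.single_le_sum (f := fun p => e p g) (fun _ _ => Real.exp_nonneg _)
        (Finset.mem_product.mpr ⟨hx, hy⟩)
    have h1 : Real.exp (Real.sqrt N * schmidtCoeff (WithLp.toLp 2 g : State N) ⟨0, hN⟩ - 15 * N) ≤
        Real.exp (-(15 * N)) * ∑ p ∈ T ×ˢ T, e p g := by
      rw [sub_eq_neg_add, Real.exp_add]
      gcongr
      refine le_trans ?_ hle
      exact Real.exp_le_exp.mpr (mul_le_mul_of_nonneg_left hxy (Real.sqrt_nonneg _))
    have h2 := mul_le_mul_of_nonneg_left h1 (by positivity : 0 ≤ 4 / (N : ℝ))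
    linarith

theorem norm_normalizedState_le (N : ℕ) (g : Fin N × Fin N → ℂ) : ‖normalizedState N g‖ ≤ 1 := by
  rw [normalizedState, norm_smul, Complex.norm_real, norm_inv, norm_norm]
  exact inv_mul_le_one

theorem norm_normalizedState {N : ℕ} {g : Fin N × Fin N → ℂ} (hg : g ≠ 0) :
    ‖normalizedState N g‖ = 1 := by
  have : ‖(WithLp.toLp 2 g : State N)‖ ≠ 0 := by simpa using hg
  rw [normalizedState, norm_smul, Complex.norm_real, norm_inv, norm_norm, inv_mul_cancel₀ this]

theorem schmidtCoeff_zero_smul_le {N : ℕ} (hN : 0 < N) (r : ℝ) (φ : State N) :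
    schmidtCoeff ((r : ℂ) • φ) ⟨0, hN⟩ ≤ |r| * schmidtCoeff φ ⟨0, hN⟩ := by
  obtain ⟨v, hv, hAv⟩ := (amplitudeMap ((r : ℂ) • φ)).exists_norm_apply_eq_singularValues_zero
    (by simpa using hN)
  rw [schmidtCoeff_eq, schmidtCoeff_eq, ← hAv, amplitudeMap_smul, norm_smul, Complex.norm_real,
    Real.norm_eq_abs]
  refine mul_le_mul_of_nonneg_left ?_ (abs_nonneg r)
  simpa [hv] using (amplitudeMap φ).norm_apply_le_singularValues_zero v

/-- Split at `‖g‖² = N²/2`, a quarter of the mean `2N²`. Above it, normalizing costs a factor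
`2/N²`; below it, the coefficient is at most 1 and the exponential term is at least 1. -/
theorem sq_schmidtCoeff_normalizedState_le {N : ℕ} (hN : 0 < N) (g : Fin N × Fin N → ℂ) :
    schmidtCoeff (normalizedState N g) ⟨0, hN⟩ ^ 2 ≤
      2 / N ^ 2 * schmidtCoeff (WithLp.toLp 2 g : State N) ⟨0, hN⟩ ^ 2 +
        Real.exp (N ^ 2 / 2) * Real.exp (-‖(WithLp.toLp 2 g : State N)‖ ^ 2) := by
  have hN' : (0 : ℝ) < N := by exact_mod_cast hN
  set φ : State N := WithLp.toLp 2 g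
  have h0 := schmidtCoeff_nonneg (normalizedState N g) ⟨0, hN⟩
  rcases le_total (‖φ‖ ^ 2) (N ^ 2 / 2 : ℝ) with h | h
  · have h1 : schmidtCoeff (normalizedState N g) ⟨0, hN⟩ ≤ 1 :=
      (schmidtCoeff_le_norm _ _).trans (norm_normalizedState_le N g)
    have h2 : 1 ≤ Real.exp (N ^ 2 / 2) * Real.exp (-‖φ‖ ^ 2) := by
      rw [← Real.exp_add]
      exact Real.one_le_exp (by linarith)
    have h3 : 0 ≤ 2 / (N : ℝ) ^ 2 * schmidtCoeff φ ⟨0, hN⟩ ^ 2 := by positivity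
    nlinarith
  · have h1 : schmidtCoeff (normalizedState N g) ⟨0, hN⟩ ≤ ‖φ‖⁻¹ * schmidtCoeff φ ⟨0, hN⟩ := by
      have := schmidtCoeff_zero_smul_le hN ‖φ‖⁻¹ φ
      rwa [abs_of_nonneg (inv_nonneg.mpr (norm_nonneg _))] at this
    have h2 : (‖φ‖ ^ 2)⁻¹ ≤ 2 / (N : ℝ) ^ 2 := by
      rw [← inv_div]
      exact inv_anti₀ (by positivity) h
    have h3 : 0 ≤ Real.exp ((N : ℝ) ^ 2 / 2) * Real.exp (-‖φ‖ ^ 2) := by positivity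
    calc _ ≤ (‖φ‖⁻¹ * schmidtCoeff φ ⟨0, hN⟩) ^ 2 := by gcongr
      _ = (‖φ‖ ^ 2)⁻¹ * schmidtCoeff φ ⟨0, hN⟩ ^ 2 := by rw [mul_pow, inv_pow]
      _ ≤ 2 / (N : ℝ) ^ 2 * schmidtCoeff φ ⟨0, hN⟩ ^ 2 := by gcongr
      _ ≤ _ := by linarith

/-! ### The largest Schmidt coefficient of a Haar-random state -/

theorem ae_norm_le_one_haarState (N : ℕ) : ∀ᵐ φ ∂(haarState N), ‖φ‖ ≤ 1 := by
  rw [haarState, ae_map_iff (measurable_normalizedState N).aemeasurable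
    (measurableSet_le measurable_norm measurable_const)]
  exact Filter.Eventually.of_forall fun g => norm_normalizedState_le N g

instance complexGaussian_nullSingletonClass : NullSingletonClass complexGaussian := by
  have := nullSingletonClass_gaussianReal (μ := 0) (v := 1) one_ne_zero
  refine ⟨fun z => ?_⟩
  rw [complexGaussian, MeasurableEquiv.map_apply]
  have : Complex.measurableEquivRealProd.symm ⁻¹' {z} = {Complex.measurableEquivRealProd z} := by
    ext p
    exact Complex.measurableEquivRealProd.symm_apply_eq
  rw [this]
  exact measure_singleton _

theorem ae_norm_eq_one_haarState {N : ℕ} (hN : 0 < N) : ∀ᵐ φ ∂(haarState N), ‖φ‖ = 1 := by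
  rw [haarState, ae_map_iff (measurable_normalizedState N).aemeasurable
    (measurableSet_eq_fun measurable_norm measurable_const)]
  filter_upwards [Measure.ae_eval_ne (μ := fun _ : Fin N × Fin N => complexGaussian)
    (⟨0, hN⟩, ⟨0, hN⟩) 0] with g hg
  exact norm_normalizedState fun h => hg (congrFun h _)

theorem integrable_sq_schmidtCoeff {N : ℕ} (α : Fin N) :
    Integrable (fun φ => schmidtCoeff φ α ^ 2) (haarState N) := by
  refine Integrable.of_bound (C := 1) ((continuous_schmidtCoeff α).pow 2).aestronglyMeasurable ?_
  filter_upwards [ae_norm_le_one_haarState N] with φ hφ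
  rw [Real.norm_of_nonneg (sq_nonneg _)]
  exact pow_le_one₀ (schmidtCoeff_nonneg _ _) ((schmidtCoeff_le_norm _ _).trans hφ)

theorem integral_sq_schmidtCoeff_zero_le {N : ℕ} (hN : 0 < N) :
    ∫ φ, schmidtCoeff φ ⟨0, hN⟩ ^ 2 ∂(haarState N) ≤ 910 / N := by
  have hN' : (0 : ℝ) < N := by exact_mod_cast hN
  have hN1 : (1 : ℝ) ≤ N := by exact_mod_cast hN
  obtain ⟨B, hB, hBint, hle⟩ := exists_dominating_ginibre hN
  have h2 := exp_neg_norm_sq_ginibre N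
  rw [haarState, integral_map (measurable_normalizedState N).aemeasurable
    (integrable_sq_schmidtCoeff ⟨0, hN⟩).aestronglyMeasurable]
  calc ∫ g, schmidtCoeff (normalizedState N g) ⟨0, hN⟩ ^ 2 ∂(ginibre N)
      ≤ ∫ g, (2 / N ^ 2 * B g + Real.exp (N ^ 2 / 2) *
          Real.exp (-‖(WithLp.toLp 2 g : State N)‖ ^ 2)) ∂(ginibre N) := by
        refine integral_mono_of_nonneg (Filter.Eventually.of_forall fun g => sq_nonneg _)
          ((hB.const_mul _).add (h2.1.const_mul _)) (Filter.Eventually.of_forall fun g => ?_)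
        refine (sq_schmidtCoeff_normalizedState_le hN g).trans ?_
        have h3 := mul_le_mul_of_nonneg_left (hle g) (by positivity : 0 ≤ 2 / (N : ℝ) ^ 2)
        linarith
    _ = 2 / N ^ 2 * ∫ g, B g ∂(ginibre N) + Real.exp (N ^ 2 / 2) * (1 / 3) ^ N ^ 2 := by
        rw [integral_add (hB.const_mul _) (h2.1.const_mul _), integral_const_mul,
          integral_const_mul, h2.2]
    _ ≤ 2 / N ^ 2 * (454 * N) + 2 / N := by
        gcongr
        -- Since `√e ≤ 2`, the small-norm term is at most `(2/3)^(N²)`, which Bernoulli's inequality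
        -- bounds by `2/N`.
        have h3 : Real.exp ((N : ℝ) ^ 2 / 2) ≤ 2 ^ N ^ 2 := by
          have : ((N : ℝ) ^ 2 / 2) = ((N ^ 2 : ℕ) : ℝ) * (1 / 2) := by push_cast; ring
          rw [this, Real.exp_nat_mul]
          refine pow_le_pow_left₀ (Real.exp_nonneg _) ?_ _
          refine le_of_sq_le_sq ?_ (by norm_num)
          rw [← Real.exp_nat_mul]
          norm_num
          linarith [Real.exp_one_lt_d9]
        have h4 : 1 + ((N ^ 2 : ℕ) : ℝ) * (1 / 2) ≤ (3 / 2) ^ N ^ 2 := by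
          have := one_add_mul_le_pow (a := (1 / 2 : ℝ)) (by norm_num) (N ^ 2)
          norm_num at this ⊢
          exact this
        calc Real.exp ((N : ℝ) ^ 2 / 2) * (1 / 3) ^ N ^ 2 ≤ 2 ^ N ^ 2 * (1 / 3) ^ N ^ 2 := by gcongr
          _ = ((3 / 2) ^ N ^ 2)⁻¹ := by rw [← mul_pow, ← inv_pow]; norm_num
          _ ≤ ((N : ℝ) / 2)⁻¹ := by
              refine inv_anti₀ (by positivity) (le_trans ?_ h4)
              push_cast
              nlinarith
          _ = 2 / N := by rw [inv_div]
    _ = 910 / N := by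
        field_simp
        norm_num

end XEB

namespace XEB

/-! ### Fourth moments of a row of a Haar-random unitary -/

instance haarUnitary_isHaarMeasure (N : ℕ) : (haarUnitary N).IsHaarMeasure := by
  unfold haarUnitary; infer_instance

/-- A right translate is again a Haar probability measure, so uniqueness applies. Right
multiplication is the action that mixes the entries within a row. -/
instance haarUnitary_isMulRightInvariant (N : ℕ) : (haarUnitary N).IsMulRightInvariant :=
  ⟨fun g => by
    have : IsProbabilityMeasure ((haarUnitary N).map (· * g)) :=
      Measure.isProbabilityMeasure_map (measurable_mul_const g).aemeasurable
    exact Measure.isHaarMeasure_eq_of_isProbabilityMeasure _ _⟩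

variable {N : ℕ}

theorem integrable_haarUnitary {E : Type*} [NormedAddCommGroup E]
    {f : Matrix.unitaryGroup (Fin N) ℂ → E} (hf : Continuous f) : Integrable f (haarUnitary N) :=
  hf.integrable_of_hasCompactSupport (HasCompactSupport.of_compactSpace f)

@[fun_prop]
theorem continuous_unitaryGroup_apply (a α : Fin N) :
    Continuous fun U : Matrix.unitaryGroup (Fin N) ℂ => U.1 a α :=
  continuous_subtype_val.matrix_elem a α

/-- The diagonal unitary with phase `z` at the index `κ` and `1` elsewhere. -/
def phaseUnitary (κ : Fin N) (z : ℂ) (hz : z * star z = 1) : Matrix.unitaryGroup (Fin N) ℂ :=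
  ⟨Matrix.diagonal fun i => if i = κ then z else 1, by
    rw [Matrix.mem_unitaryGroup_iff, Matrix.star_eq_conjTranspose, Matrix.diagonal_conjTranspose,
      Matrix.diagonal_mul_diagonal, ← Matrix.diagonal_one]
    congr 1
    ext i
    by_cases h : i = κ
    · simpa [h] using hz
    · simp [h]⟩

theorem mul_phaseUnitary_apply (U : Matrix.unitaryGroup (Fin N) ℂ) (κ : Fin N) (z : ℂ)
    (hz : z * star z = 1) (a α : Fin N) :
    (U * phaseUnitary κ z hz).1 a α = U.1 a α * if α = κ then z else 1 := by
  simp [phaseUnitary, Matrix.mul_diagonal]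

/-- The moment `E[u_α conj(u_β) u_γ conj(u_δ)]` of the row `u` of index `a`. -/
def rowMoment (a α β γ δ : Fin N) : ℂ :=
  ∫ U, U.1 a α * star (U.1 a β) * U.1 a γ * star (U.1 a δ) ∂(haarUnitary N)

/-- Invariance under multiplying column `κ` by `i`. The phase `i`, unlike `-1`, distinguishes
conjugated from unconjugated entries. -/
theorem rowMoment_eq_phase_mul (a α β γ δ κ : Fin N) :
    rowMoment a α β γ δ = (if α = κ then Complex.I else 1) * (if β = κ then -Complex.I else 1) *
      (if γ = κ then Complex.I else 1) * (if δ = κ then -Complex.I else 1) *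
        rowMoment a α β γ δ := by
  rw [rowMoment, ← integral_const_mul,
    ← integral_mul_right_eq_self _ (phaseUnitary κ Complex.I (by simp))]
  congr 1
  ext U
  have h : ∀ μ : Fin N, star (if μ = κ then Complex.I else 1) = if μ = κ then -Complex.I else 1 := by
    intro μ
    split_ifs <;> simp
  simp_rw [mul_phaseUnitary_apply, star_mul', h]
  ring

theorem rowMoment_eq_zero {a α β γ δ : Fin N} (h1 : ¬(α = β ∧ γ = δ)) (h2 : ¬(α = δ ∧ β = γ)) :
    rowMoment a α β γ δ = 0 := by
  have hI : Complex.I ≠ 1 := fun h => by simpa using congrArg Complex.re h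
  have key : ∀ c : ℂ, c ≠ 1 → rowMoment a α β γ δ = c * rowMoment a α β γ δ →
      rowMoment a α β γ δ = 0 := by
    intro c hc h
    have : (1 - c) * rowMoment a α β γ δ = 0 := by rw [sub_mul, one_mul, ← h, sub_self]
    exact (mul_eq_zero.mp this).resolve_left (sub_ne_zero.mpr hc.symm)
  -- If `α` is matched by a conjugated index, the other pair is unmatched and rotating column `γ`
  -- gives the phase `i`. Otherwise rotating column `α` gives `i` or `-1`.
  by_cases hα : α = β ∨ α = δ
  · refine key _ ?_ (rowMoment_eq_phase_mul a α β γ δ γ)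
    rcases hα with rfl | rfl
    · have : δ ≠ γ := fun h => h1 ⟨rfl, h.symm⟩
      by_cases h : α = γ <;> simp [h, this, hI]
    · have : β ≠ γ := fun h => h2 ⟨rfl, h⟩
      by_cases h : α = γ <;> simp [h, this, hI]
  · push Not at hα
    refine key _ ?_ (rowMoment_eq_phase_mul a α β γ δ α)
    have h3 : (-1 : ℂ) ≠ 1 := by norm_num
    by_cases h : γ = α <;> simp [h, hα.1.symm, hα.2.symm, hI, h3]

/-- The mixed second moment `E[|u_α|² |u_β|²]` of the row `u` of index `a`. -/
def sqMoment (a α β : Fin N) : ℝ :=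
  ∫ U, Complex.normSq (U.1 a α) * Complex.normSq (U.1 a β) ∂(haarUnitary N)

/-- The rotation by `π / 4`, composed with a reflection, in the plane of two coordinates. -/
def hadamardMatrix (α β : Fin N) : Matrix (Fin N) (Fin N) ℂ := fun i j =>
  if j = α then (if i = α ∨ i = β then ((Real.sqrt 2)⁻¹ : ℝ) else 0)
  else if j = β then (if i = α then ((Real.sqrt 2)⁻¹ : ℝ)
    else if i = β then -((Real.sqrt 2)⁻¹ : ℝ) else 0)
  else if i = j then 1 else 0

theorem sum_mul_hadamardMatrix {α β : Fin N} (h : α ≠ β) (f : Fin N → ℂ) (j : Fin N) :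
    ∑ k, f k * hadamardMatrix α β k j =
      if j = α then ((Real.sqrt 2)⁻¹ : ℝ) * (f α + f β)
      else if j = β then ((Real.sqrt 2)⁻¹ : ℝ) * (f α - f β) else f j := by
  by_cases hjα : j = α
  · rw [Finset.sum_eq_add α β h (fun k _ hk => by simp [hadamardMatrix, hjα, hk.1, hk.2])
      (by simp) (by simp)]
    simp [hadamardMatrix, hjα]
    ring
  · by_cases hjβ : j = β
    · rw [Finset.sum_eq_add α β h
        (fun k _ hk => by simp [hadamardMatrix, hjβ, hk.1, hk.2, h.symm]) (by simp) (by simp)]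
      simp [hadamardMatrix, hjβ, h.symm]
      ring
    · simp [hadamardMatrix, hjα, hjβ]

theorem hadamardMatrix_mem {α β : Fin N} (h : α ≠ β) :
    hadamardMatrix α β ∈ Matrix.unitaryGroup (Fin N) ℂ := by
  have hr : (((Real.sqrt 2)⁻¹ : ℝ) : ℂ) * ((Real.sqrt 2)⁻¹ : ℝ) = 1 / 2 := by
    rw [← Complex.ofReal_mul, ← mul_inv, Real.mul_self_sqrt (by norm_num)]
    norm_num
  have hstar : star (hadamardMatrix α β) = hadamardMatrix α β := by
    ext i j
    rw [Matrix.star_apply]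
    by_cases h1 : i = α <;> by_cases h2 : i = β <;> by_cases h3 : j = α <;> by_cases h4 : j = β <;>
      by_cases h5 : i = j <;> simp_all [hadamardMatrix, eq_comm]
  rw [Matrix.mem_unitaryGroup_iff, hstar]
  ext i j
  rw [Matrix.mul_apply, sum_mul_hadamardMatrix h]
  by_cases h1 : i = α <;> by_cases h2 : i = β <;> by_cases h3 : j = α <;> by_cases h4 : j = β <;>
    by_cases h5 : i = j <;> simp_all [hadamardMatrix, Matrix.one_apply]
  all_goals
    rw [mul_add, hr]
    norm_num

theorem integral_normSq_add_sq {a α β : Fin N} (h : α ≠ β) (z : ℂ) (hz : z * star z = 1) :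
    ∫ U, Complex.normSq (U.1 a α + z * U.1 a β) ^ 2 ∂(haarUnitary N) =
      ∫ U, Complex.normSq (U.1 a α + U.1 a β) ^ 2 ∂(haarUnitary N) := by
  rw [← integral_mul_right_eq_self (fun U : Matrix.unitaryGroup (Fin N) ℂ =>
    Complex.normSq (U.1 a α + U.1 a β) ^ 2) (phaseUnitary β z hz)]
  simp [mul_phaseUnitary_apply, h, mul_comm z]

/-- Averaging `|u + zv|⁴` over the fourth roots of unity leaves only terms in `|u|²` and `|v|²`; by
phase invariance all four have the same Haar integral. -/
theorem sum_normSq_add_sq (u v : ℂ) :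
    Complex.normSq (u + 1 * v) ^ 2 + Complex.normSq (u + (-1) * v) ^ 2 +
      Complex.normSq (u + Complex.I * v) ^ 2 + Complex.normSq (u + (-Complex.I) * v) ^ 2 =
    4 * (Complex.normSq u * Complex.normSq u) + 4 * (Complex.normSq v * Complex.normSq v) +
      16 * (Complex.normSq u * Complex.normSq v) := by
  simp [Complex.normSq_apply]
  ring

theorem integral_normSq_add_sq_eq {a α β : Fin N} (h : α ≠ β) :
    ∫ U, Complex.normSq (U.1 a α + U.1 a β) ^ 2 ∂(haarUnitary N) =
      sqMoment a α α + sqMoment a β β + 4 * sqMoment a α β := by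
  have hi : ∀ z : ℂ, Integrable (fun U : Matrix.unitaryGroup (Fin N) ℂ =>
      Complex.normSq (U.1 a α + z * U.1 a β) ^ 2) (haarUnitary N) := fun z =>
    integrable_haarUnitary ((Complex.continuous_normSq.comp (by fun_prop)).pow 2)
  have hj : ∀ μ ν : Fin N, Integrable (fun U : Matrix.unitaryGroup (Fin N) ℂ =>
      Complex.normSq (U.1 a μ) * Complex.normSq (U.1 a ν)) (haarUnitary N) := fun μ ν =>
    integrable_haarUnitary ((Complex.continuous_normSq.comp (by fun_prop)).mul
      (Complex.continuous_normSq.comp (by fun_prop)))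
  have key : ∫ U : Matrix.unitaryGroup (Fin N) ℂ,
      (Complex.normSq (U.1 a α + 1 * U.1 a β) ^ 2 + Complex.normSq (U.1 a α + (-1) * U.1 a β) ^ 2 +
        Complex.normSq (U.1 a α + Complex.I * U.1 a β) ^ 2 +
        Complex.normSq (U.1 a α + (-Complex.I) * U.1 a β) ^ 2) ∂(haarUnitary N) =
      ∫ U : Matrix.unitaryGroup (Fin N) ℂ,
        (4 * (Complex.normSq (U.1 a α) * Complex.normSq (U.1 a α)) +
          4 * (Complex.normSq (U.1 a β) * Complex.normSq (U.1 a β)) +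
          16 * (Complex.normSq (U.1 a α) * Complex.normSq (U.1 a β))) ∂(haarUnitary N) := by
    simp_rw [sum_normSq_add_sq]
  rw [integral_add (((hi _).fun_add (hi _)).fun_add (hi _)) (hi _),
    integral_add ((hi _).fun_add (hi _)) (hi _), integral_add (hi _) (hi _),
    integral_add (((hj _ _).const_mul _).fun_add ((hj _ _).const_mul _)) ((hj _ _).const_mul _),
    integral_add ((hj _ _).const_mul _) ((hj _ _).const_mul _), integral_const_mul,
    integral_const_mul, integral_const_mul, integral_normSq_add_sq h 1 (by simp),
    integral_normSq_add_sq h (-1) (by simp), integral_normSq_add_sq h Complex.I (by simp),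
    integral_normSq_add_sq h (-Complex.I) (by simp)] at key
  unfold sqMoment
  linarith

/-- The Hadamard rotation sends `u_α` to `(u_α + u_β)/√2`. Together with the relation with `α` and
`β` exchanged, this forces equal fourth moments and a mixed moment of half that size. -/
theorem sqMoment_self_left {a α β : Fin N} (h : α ≠ β) :
    4 * sqMoment a α α = sqMoment a α α + sqMoment a β β + 4 * sqMoment a α β := by
  rw [← integral_normSq_add_sq_eq h, sqMoment,
    ← integral_mul_right_eq_self _ (⟨_, hadamardMatrix_mem h⟩ : Matrix.unitaryGroup (Fin N) ℂ),
    ← integral_const_mul]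
  congr 1
  ext U
  rw [Submonoid.coe_mul, Matrix.mul_apply, sum_mul_hadamardMatrix h, if_pos rfl, Complex.normSq_mul,
    Complex.normSq_ofReal, ← mul_inv, Real.mul_self_sqrt (by norm_num)]
  ring

theorem sqMoment_comm (a α β : Fin N) : sqMoment a α β = sqMoment a β α := by
  simp_rw [sqMoment, mul_comm]

theorem sqMoment_of_ne {a α β : Fin N} (h : α ≠ β) : sqMoment a α β = sqMoment a α α / 2 := by
  have h1 := sqMoment_self_left (a := a) h
  have h2 := sqMoment_self_left (a := a) h.symm
  rw [sqMoment_comm a β α] at h2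
  linarith

theorem sqMoment_self_eq (a α β : Fin N) : sqMoment a α α = sqMoment a β β := by
  rcases eq_or_ne α β with rfl | h
  · rfl
  have h1 := sqMoment_self_left (a := a) h
  have h2 := sqMoment_self_left (a := a) h.symm
  rw [sqMoment_comm a β α] at h2
  linarith

theorem sum_normSq_row (U : Matrix.unitaryGroup (Fin N) ℂ) (a : Fin N) :
    ∑ α, Complex.normSq (U.1 a α) = 1 := by
  have h := congrFun (congrFun (Matrix.mem_unitaryGroup_iff.mp U.2) a) a
  rw [Matrix.mul_apply, Matrix.one_apply_eq] at h
  have h2 : ((∑ α, Complex.normSq (U.1 a α) : ℝ) : ℂ) = 1 := by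
    rw [← h]
    push_cast
    exact Finset.sum_congr rfl fun α _ => Complex.normSq_eq_conj_mul_self.trans (mul_comm _ _)
  exact_mod_cast h2

theorem sum_sqMoment (a : Fin N) : ∑ α, ∑ β, sqMoment a α β = 1 := by
  have hj : ∀ μ ν : Fin N, Integrable (fun U : Matrix.unitaryGroup (Fin N) ℂ =>
      Complex.normSq (U.1 a μ) * Complex.normSq (U.1 a ν)) (haarUnitary N) := fun μ ν =>
    integrable_haarUnitary ((Complex.continuous_normSq.comp (by fun_prop)).mul
      (Complex.continuous_normSq.comp (by fun_prop)))
  simp_rw [sqMoment]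
  simp_rw [← integral_finsetSum _ fun β _ => hj _ β]
  rw [← integral_finsetSum _ fun α _ => integrable_finsetSum _ fun β _ => hj α β]
  simp_rw [← Finset.sum_mul_sum, sum_normSq_row]
  simp

/-- Fixed by normalization: expanding `(∑ |u_α|²)² = 1` gives `N(N+1)/2` times this moment. -/
theorem sqMoment_self (a α : Fin N) : sqMoment a α α = 2 / (N * (N + 1)) := by
  have hN : (0 : ℝ) < N := by exact_mod_cast α.pos
  have h := sum_sqMoment a
  have h1 : ∀ μ, ∑ ν, sqMoment a μ ν = sqMoment a α α * ((N + 1) / 2) := by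
    intro μ
    rw [← Finset.add_sum_erase _ _ (Finset.mem_univ μ),
      Finset.sum_congr rfl fun ν hν => (sqMoment_of_ne (Finset.ne_of_mem_erase hν).symm),
      Finset.sum_const, Finset.card_erase_of_mem (Finset.mem_univ μ), Finset.card_univ,
      Fintype.card_fin, nsmul_eq_mul, Nat.cast_sub α.pos, sqMoment_self_eq a μ α]
    push_cast
    ring
  simp_rw [h1] at h
  rw [Finset.sum_const, Finset.card_univ, Fintype.card_fin, nsmul_eq_mul] at h
  rw [eq_div_iff (by positivity)]
  linarith

theorem rowMoment_pair (a α β : Fin N) : rowMoment a α α β β = sqMoment a α β := by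
  rw [sqMoment, rowMoment, ← integral_complex_ofReal]
  congr 1
  ext U
  rw [Complex.ofReal_mul, Complex.normSq_eq_conj_mul_self, Complex.normSq_eq_conj_mul_self]
  simp only [Complex.star_def]
  ring

/-- The fourth moments of a row of a Haar-random unitary. -/
theorem rowMoment_eq (a α β γ δ : Fin N) :
    rowMoment a α β γ δ = ((if α = β then 1 else 0) * (if γ = δ then 1 else 0) +
      (if α = δ then 1 else 0) * (if β = γ then 1 else 0)) / (N * (N + 1)) := by
  have hswap : rowMoment a α β γ δ = rowMoment a α δ γ β := by
    unfold rowMoment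
    congr 1
    ext U
    ring
  have hpair : ∀ μ ν : Fin N, rowMoment a μ μ ν ν =
      (1 + if μ = ν then 1 else 0) / (N * (N + 1)) := by
    intro μ ν
    rw [rowMoment_pair]
    by_cases h : μ = ν
    · rw [h, sqMoment_self]
      push_cast
      simp only [if_true]
      norm_num
    · rw [sqMoment_of_ne h, sqMoment_self]
      push_cast
      simp only [h, if_false]
      ring
  by_cases h1 : α = β ∧ γ = δ
  · obtain ⟨rfl, rfl⟩ := h1
    rw [hpair]
    by_cases h : α = γ <;> simp [h]
  · by_cases h2 : α = δ ∧ β = γ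
    · obtain ⟨rfl, rfl⟩ := h2
      rw [hswap, hpair]
      have : α ≠ β := fun h => h1 ⟨h, h.symm⟩
      simp [this]
    · rw [rowMoment_eq_zero h1 h2]
      have e1 : (if α = β then (1 : ℂ) else 0) * (if γ = δ then 1 else 0) = 0 := by
        by_cases h : α = β <;> simp_all
      have e2 : (if α = δ then (1 : ℂ) else 0) * (if β = γ then 1 else 0) = 0 := by
        by_cases h : α = δ <;> simp_all
      rw [e1, e2]
      simp

end XEB

namespace XEB

/-! ### Superpositions of the product vectors -/

variable {N : ℕ}

/-- The superposition `∑_α x_α |l_α⟩ ⊗ |r_α⟩` with real coefficients. -/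
def superposition (x : Fin N → ℝ) (ω : Sample N) : State N := ∑ α, (x α : ℂ) • nu ω α

/-- The coefficients of the truncated state. -/
def truncCoeff (χ : ℕ) (ω : Sample N) (α : Fin N) : ℝ :=
  if α.val < χ then (Real.sqrt (weight χ ω))⁻¹ * S ω α else 0

theorem psi_eq (ω : Sample N) : psi ω = superposition (S ω) ω := rfl

theorem psiTrunc_eq (χ : ℕ) (ω : Sample N) :
    psiTrunc χ ω = superposition (truncCoeff χ ω) ω := by
  rw [psiTrunc, superposition, Finset.smul_sum, Finset.sum_filter]
  refine Finset.sum_congr rfl fun α _ => ?_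
  rw [truncCoeff]
  split_ifs
  · rw [smul_smul, Complex.ofReal_mul, Complex.ofReal_inv]
  · rw [Complex.ofReal_zero, zero_smul]

theorem superposition_apply (x : Fin N → ℝ) (ω : Sample N) (j : Fin N × Fin N) :
    superposition x ω j = ∑ α, (x α : ℂ) * (ω.2.1.1 j.1 α * ω.2.2.1 j.2 α) := by
  simp [superposition, nu]

theorem sum_star_mul_column (U : Matrix.unitaryGroup (Fin N) ℂ) (α β : Fin N) :
    ∑ a, star (U.1 a α) * U.1 a β = if α = β then 1 else 0 := by
  have h := congrFun (congrFun (Matrix.mem_unitaryGroup_iff'.mp U.2) α) β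
  rwa [Matrix.mul_apply, Matrix.one_apply] at h

theorem orthonormal_nu (ω : Sample N) : Orthonormal ℂ (nu ω) := by
  rw [orthonormal_iff_ite]
  intro α β
  have h : inner ℂ (nu ω α) (nu ω β) =
      (∑ a, star (ω.2.1.1 a α) * ω.2.1.1 a β) * ∑ b, star (ω.2.2.1 b α) * ω.2.2.1 b β := by
    rw [PiLp.inner_apply, Fintype.sum_prod_type, Finset.sum_mul_sum]
    refine Finset.sum_congr rfl fun a _ => Finset.sum_congr rfl fun b _ => ?_
    simp only [nu, RCLike.inner_apply, map_mul, Complex.star_def]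
    ring
  rw [h, sum_star_mul_column, sum_star_mul_column]
  split_ifs <;> simp

theorem inner_superposition (x y : Fin N → ℝ) (ω : Sample N) :
    inner ℂ (superposition x ω) (superposition y ω) = ((∑ α, x α * y α : ℝ) : ℂ) := by
  rw [superposition, superposition, (orthonormal_nu ω).inner_sum]
  push_cast
  simp

theorem norm_sq_superposition (x : Fin N → ℝ) (ω : Sample N) :
    ‖superposition x ω‖ ^ 2 = ∑ α, x α ^ 2 := by
  have h := inner_superposition x x ω
  rw [inner_self_eq_norm_sq_to_K] at h
  have h2 : ((‖superposition x ω‖ ^ 2 : ℝ) : ℂ) = ((∑ α, x α * x α : ℝ) : ℂ) := by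
    rw [← h]
    push_cast
    rfl
  rw [Complex.ofReal_inj.mp h2]
  simp_rw [sq]

theorem prob_le_norm_sq (φ : State N) (j : Fin N × Fin N) : prob φ j ≤ ‖φ‖ ^ 2 := by
  rw [EuclideanSpace.norm_sq_eq]
  exact Finset.single_le_sum (f := fun j => ‖φ j‖ ^ 2) (fun _ _ => sq_nonneg _) (Finset.mem_univ j)

theorem sum_prob (φ : State N) : ∑ j, prob φ j = ‖φ‖ ^ 2 := (EuclideanSpace.norm_sq_eq φ).symm

theorem weight_nonneg (χ : ℕ) (ω : Sample N) : 0 ≤ weight χ ω :=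
  Finset.sum_nonneg fun _ _ => sq_nonneg _

theorem sum_sq_S (ω : Sample N) : ∑ α, S ω α ^ 2 = ‖ω.1‖ ^ 2 := sum_sq_schmidtCoeff ω.1

theorem weight_le (χ : ℕ) (ω : Sample N) : weight χ ω ≤ ‖ω.1‖ ^ 2 := by
  rw [← sum_sq_S]
  exact Finset.sum_le_univ_sum_of_nonneg fun _ => sq_nonneg _

theorem sum_S_mul_truncCoeff (χ : ℕ) (ω : Sample N) :
    ∑ α, S ω α * truncCoeff χ ω α = Real.sqrt (weight χ ω) := by
  have h : ∀ α, S ω α * truncCoeff χ ω α =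
      if α.val < χ then (Real.sqrt (weight χ ω))⁻¹ * S ω α ^ 2 else 0 := by
    intro α
    unfold truncCoeff
    split_ifs <;> ring
  simp_rw [h]
  rw [← Finset.sum_filter, ← Finset.mul_sum]
  change (Real.sqrt (weight χ ω))⁻¹ * weight χ ω = _
  rw [inv_mul_eq_div, Real.div_sqrt]

/-- Kept as `w⁻¹ * w`, which is 0 for zero weight, so that no positivity hypothesis is needed. -/
theorem sum_sq_truncCoeff (χ : ℕ) (ω : Sample N) :
    ∑ α, truncCoeff χ ω α ^ 2 = (weight χ ω)⁻¹ * weight χ ω := by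
  have h : ∀ α, truncCoeff χ ω α ^ 2 =
      if α.val < χ then (weight χ ω)⁻¹ * S ω α ^ 2 else 0 := by
    intro α
    unfold truncCoeff
    split_ifs
    · rw [mul_pow, inv_pow, Real.sq_sqrt (weight_nonneg χ ω)]
    · ring
  simp_rw [h]
  rw [← Finset.sum_filter, ← Finset.mul_sum]
  rfl

theorem sum_sq_truncCoeff_le_one (χ : ℕ) (ω : Sample N) : ∑ α, truncCoeff χ ω α ^ 2 ≤ 1 := by
  rw [sum_sq_truncCoeff]
  exact inv_mul_le_one

theorem fidelity_eq_weight (χ : ℕ) (ω : Sample N) : fidelity χ ω = weight χ ω := by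
  rw [fidelity, psi_eq, psiTrunc_eq, inner_superposition, sum_S_mul_truncCoeff, Complex.norm_real,
    Real.norm_of_nonneg (Real.sqrt_nonneg _), Real.sq_sqrt (weight_nonneg χ ω)]

theorem overlap_nonneg (χ : ℕ) (ω : Sample N) : 0 ≤ overlap χ ω :=
  Finset.sum_nonneg fun _ _ => mul_nonneg (sq_nonneg _) (sq_nonneg _)

theorem overlap_le (χ : ℕ) (ω : Sample N) : overlap χ ω ≤ ‖ω.1‖ ^ 2 := by
  have h1 : ‖psiTrunc χ ω‖ ^ 2 ≤ 1 := by
    rw [psiTrunc_eq, norm_sq_superposition]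
    exact sum_sq_truncCoeff_le_one χ ω
  have h2 : ‖psi ω‖ ^ 2 = ‖ω.1‖ ^ 2 := by rw [psi_eq, norm_sq_superposition, sum_sq_S]
  rw [← h2, ← sum_prob]
  exact Finset.sum_le_sum fun j _ =>
    mul_le_of_le_one_right (sq_nonneg _) ((prob_le_norm_sq _ j).trans h1)

/-! ### Measurability and integrability -/

theorem measurable_S (α : Fin N) : Measurable fun ω : Sample N => S ω α :=
  (continuous_schmidtCoeff α).measurable.comp measurable_fst

theorem measurable_weight (χ : ℕ) : Measurable fun ω : Sample N => weight χ ω :=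
  Finset.measurable_sum _ fun α _ => (measurable_S α).pow_const 2

theorem measurable_truncCoeff (χ : ℕ) (α : Fin N) :
    Measurable fun ω : Sample N => truncCoeff χ ω α := by
  unfold truncCoeff
  split_ifs
  · exact ((Real.continuous_sqrt.measurable.comp (measurable_weight χ)).inv).mul (measurable_S α)
  · exact measurable_const

theorem measurable_prob_superposition {x : Sample N → Fin N → ℝ}
    (hx : ∀ α, Measurable fun ω => x ω α) (j : Fin N × Fin N) :
    Measurable fun ω => prob (superposition (x ω) ω) j := by
  simp_rw [prob, superposition_apply]
  refine (Finset.measurable_sum _ fun α _ => ?_).norm.pow_const 2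
  exact (Complex.measurable_ofReal.comp (hx α)).mul
    (((continuous_unitaryGroup_apply j.1 α).measurable.comp (measurable_fst.comp measurable_snd)).mul
      ((continuous_unitaryGroup_apply j.2 α).measurable.comp (measurable_snd.comp measurable_snd)))

theorem measurable_overlap (χ : ℕ) : Measurable fun ω : Sample N => overlap χ ω := by
  unfold overlap
  refine Finset.measurable_sum _ fun j _ => ?_
  simp_rw [psiTrunc_eq, psi_eq]
  exact (measurable_prob_superposition measurable_S j).mul
    (measurable_prob_superposition (measurable_truncCoeff χ) j)

theorem ae_norm_fst_le_one_model (N : ℕ) : ∀ᵐ ω ∂(model N), ‖ω.1‖ ≤ 1 :=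
  Measure.quasiMeasurePreserving_fst.ae (ae_norm_le_one_haarState N)

theorem integrable_overlap (χ : ℕ) : Integrable (fun ω => overlap χ ω) (model N) := by
  refine Integrable.of_bound (C := 1) (measurable_overlap χ).aestronglyMeasurable ?_
  filter_upwards [ae_norm_fst_le_one_model N] with ω hω
  rw [Real.norm_of_nonneg (overlap_nonneg χ ω)]
  exact (overlap_le χ ω).trans (pow_le_one₀ (norm_nonneg _) hω)

theorem integrable_fidelity (χ : ℕ) : Integrable (fun ω => fidelity χ ω) (model N) := by
  simp_rw [fidelity_eq_weight]
  refine Integrable.of_bound (C := 1) (measurable_weight χ).aestronglyMeasurable ?_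
  filter_upwards [ae_norm_fst_le_one_model N] with ω hω
  rw [Real.norm_of_nonneg (weight_nonneg χ ω)]
  exact (weight_le χ ω).trans (pow_le_one₀ (norm_nonneg _) hω)

/-! ### The average over the Schmidt vectors -/

/-- Both factors carry the same sum of two pairing indicators, whose square is the sum itself plus
twice their product. The product forces all four indices equal, whence `2 ∑ x_α² y_α²`. -/
theorem sum_rowMoment_sq (x y : Fin N → ℝ) (a b : Fin N) :
    ∑ α, ∑ β, ∑ γ, ∑ δ, (x α * x β * y γ * y δ : ℂ) *
        (rowMoment a α β γ δ * rowMoment b α β γ δ) =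
      (((∑ α, x α ^ 2) * (∑ α, y α ^ 2) + (∑ α, x α * y α) ^ 2 +
        2 * ∑ α, x α ^ 2 * y α ^ 2 : ℝ) : ℂ) / (N * (N + 1)) ^ 2 := by
  have h : ∀ α β γ δ : Fin N, (x α * x β * y γ * y δ : ℂ) *
      (rowMoment a α β γ δ * rowMoment b α β γ δ) =
      ((if α = β then (if γ = δ then (x α * x β * y γ * y δ : ℂ) else 0) else 0) +
        (if α = δ then (if β = γ then (x α * x β * y γ * y δ : ℂ) else 0) else 0) +
        (if α = β then (if γ = δ then (if α = δ then 2 * (x α * x β * y γ * y δ : ℂ) else 0) else 0)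
          else 0)) / (N * (N + 1)) ^ 2 := by
    intro α β γ δ
    rw [rowMoment_eq, rowMoment_eq]
    generalize (N * (N + 1) : ℂ) = K
    by_cases h1 : α = β
    · subst h1
      by_cases h2 : γ = δ
      · subst h2
        by_cases h3 : α = γ
        · simp [h3]
          ring
        · simp [h3]
          ring
      · by_cases h3 : α = δ
        · have : α ≠ γ := fun h => h2 (h ▸ h3)
          simp [h2, this]
        · simp [h2, h3]
    · by_cases h2 : α = δ
      · by_cases h3 : β = γ
        · simp [h2, h3]
          have : δ ≠ γ := fun h => h1 (h2.trans (h.trans h3.symm))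
          simp [this]
          ring
        · simp [h1, h3]
      · simp [h1, h2]
  simp_rw [h, ← Finset.sum_div, Finset.sum_add_distrib]
  congr 1
  push_cast
  congr 1
  · congr 1
    · simp only [Finset.sum_ite_eq, Finset.mem_univ, if_true, Finset.sum_ite_irrel,
        Finset.sum_const_zero]
      rw [Finset.sum_mul_sum]
      refine Finset.sum_congr rfl fun α _ => Finset.sum_congr rfl fun γ _ => ?_
      ring
    · simp only [Finset.sum_ite_eq, Finset.mem_univ, if_true]
      rw [sq, Finset.sum_mul_sum]
      refine Finset.sum_congr rfl fun α _ => Finset.sum_congr rfl fun γ _ => ?_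
      ring
  · simp only [Finset.sum_ite_eq, Finset.mem_univ, if_true, Finset.sum_ite_irrel,
      Finset.sum_const_zero]
    rw [Finset.mul_sum]
    refine Finset.sum_congr rfl fun α _ => ?_
    ring

theorem integral_prob_mul_prob (x y : Fin N → ℝ) (φ : State N) (j : Fin N × Fin N) :
    ∫ W, prob (superposition x (φ, W)) j * prob (superposition y (φ, W)) j
        ∂((haarUnitary N).prod (haarUnitary N)) =
      ((∑ α, x α ^ 2) * (∑ α, y α ^ 2) + (∑ α, x α * y α) ^ 2 +
        2 * ∑ α, x α ^ 2 * y α ^ 2) / (N * (N + 1)) ^ 2 := by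
  rw [← Complex.ofReal_inj, ← integral_complex_ofReal]
  let m (a α β γ δ : Fin N) (U : Matrix.unitaryGroup (Fin N) ℂ) : ℂ :=
    U.1 a α * star (U.1 a β) * U.1 a γ * star (U.1 a δ)
  have hm : ∀ a α β γ δ : Fin N, Integrable (m a α β γ δ) (haarUnitary N) := fun a α β γ δ =>
    integrable_haarUnitary (by unfold m; fun_prop)
  have hexp : ∀ W : Matrix.unitaryGroup (Fin N) ℂ × Matrix.unitaryGroup (Fin N) ℂ,
      ((prob (superposition x (φ, W)) j * prob (superposition y (φ, W)) j : ℝ) : ℂ) =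
      ∑ α, ∑ β, ∑ γ, ∑ δ, (x α * x β * y γ * y δ : ℂ) *
        (m j.1 α β γ δ W.1 * m j.2 α β γ δ W.2) := by
    intro W
    have hp : ∀ z : Fin N → ℝ, ((prob (superposition z (φ, W)) j : ℝ) : ℂ) =
        ∑ α, ∑ β, (z α : ℂ) * (W.1.1 j.1 α * W.2.1 j.2 α) *
          (z β * (star (W.1.1 j.1 β) * star (W.2.1 j.2 β))) := by
      intro z
      rw [prob, superposition_apply, ← Complex.normSq_eq_norm_sq, Complex.normSq_eq_conj_mul_self,
        mul_comm, map_sum, Finset.sum_mul_sum]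
      simp
    rw [Complex.ofReal_mul, hp, hp, Finset.sum_mul]
    refine Finset.sum_congr rfl fun α _ => ?_
    rw [Finset.sum_mul]
    refine Finset.sum_congr rfl fun β _ => ?_
    rw [Finset.mul_sum]
    refine Finset.sum_congr rfl fun γ _ => ?_
    rw [Finset.mul_sum]
    refine Finset.sum_congr rfl fun δ _ => ?_
    unfold m
    ring
  have hi : ∀ α β γ δ : Fin N, Integrable
      (fun W : Matrix.unitaryGroup (Fin N) ℂ × Matrix.unitaryGroup (Fin N) ℂ =>
        (x α * x β * y γ * y δ : ℂ) * (m j.1 α β γ δ W.1 * m j.2 α β γ δ W.2))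
      ((haarUnitary N).prod (haarUnitary N)) := fun α β γ δ =>
    ((hm j.1 α β γ δ).mul_prod (hm j.2 α β γ δ)).const_mul _
  simp_rw [hexp]
  rw [integral_finsetSum _ fun α _ => integrable_finsetSum _ fun β _ =>
    integrable_finsetSum _ fun γ _ => integrable_finsetSum _ fun δ _ => hi α β γ δ]
  simp_rw [integral_finsetSum Finset.univ fun β _ =>
    integrable_finsetSum Finset.univ fun γ _ => integrable_finsetSum Finset.univ fun δ _ => hi _ β γ δ,
    integral_finsetSum Finset.univ fun γ _ => integrable_finsetSum Finset.univ fun δ _ => hi _ _ γ δ,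
    integral_finsetSum Finset.univ fun δ _ => hi _ _ _ δ, integral_const_mul]
  have hprod : ∀ α β γ δ : Fin N, ∫ W : Matrix.unitaryGroup (Fin N) ℂ × Matrix.unitaryGroup (Fin N) ℂ,
      m j.1 α β γ δ W.1 * m j.2 α β γ δ W.2 ∂((haarUnitary N).prod (haarUnitary N)) =
      rowMoment j.1 α β γ δ * rowMoment j.2 α β γ δ := fun α β γ δ =>
    integral_prod_mul (m j.1 α β γ δ) (m j.2 α β γ δ)
  simp_rw [hprod]
  rw [sum_rowMoment_sq]
  push_cast
  rfl

theorem integrable_overlap_section (χ : ℕ) (φ : State N) :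
    Integrable (fun W => overlap χ (φ, W)) ((haarUnitary N).prod (haarUnitary N)) := by
  refine Integrable.of_bound (C := ‖φ‖ ^ 2)
    ((measurable_overlap χ).comp measurable_prodMk_left).aestronglyMeasurable
    (Filter.Eventually.of_forall fun W => ?_)
  rw [Real.norm_of_nonneg (overlap_nonneg χ _)]
  exact overlap_le χ (φ, W)

/-- The average over the Schmidt vectors of the overlap of the two output distributions. -/
theorem integral_overlap_section (hN : 0 < N) (χ : ℕ) (φ : State N)
    (W₀ : Matrix.unitaryGroup (Fin N) ℂ × Matrix.unitaryGroup (Fin N) ℂ) :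
    ∫ W, overlap χ (φ, W) ∂((haarUnitary N).prod (haarUnitary N)) =
      (‖φ‖ ^ 2 * ((weight χ (φ, W₀))⁻¹ * weight χ (φ, W₀)) + weight χ (φ, W₀) +
        2 * ∑ α, schmidtCoeff φ α ^ 2 * truncCoeff χ (φ, W₀) α ^ 2) / (N + 1) ^ 2 := by
  have hN' : (N : ℝ) ≠ 0 := by exact_mod_cast hN.ne'
  let x : Fin N → ℝ := schmidtCoeff φ
  let y : Fin N → ℝ := truncCoeff χ (φ, W₀)
  have h : ∀ W, overlap χ (φ, W) =
      ∑ j, prob (superposition x (φ, W)) j * prob (superposition y (φ, W)) j := fun W => by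
    rw [overlap, psi_eq, psiTrunc_eq]
    rfl
  have hi : ∀ j, Integrable (fun W => prob (superposition x (φ, W)) j *
      prob (superposition y (φ, W)) j) ((haarUnitary N).prod (haarUnitary N)) := by
    intro j
    refine Integrable.of_bound (C := (∑ α, x α ^ 2) * ∑ α, y α ^ 2)
      (Measurable.aestronglyMeasurable ?_) (Filter.Eventually.of_forall fun W => ?_)
    · exact ((measurable_prob_superposition (x := fun _ => x) (fun _ => measurable_const) j).comp
        measurable_prodMk_left).mul
        ((measurable_prob_superposition (x := fun _ => y) (fun _ => measurable_const) j).comp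
        measurable_prodMk_left)
    · have h0 : ∀ z, 0 ≤ prob (superposition z (φ, W)) j := fun z => sq_nonneg _
      rw [Real.norm_of_nonneg (mul_nonneg (h0 x) (h0 y)),
        ← norm_sq_superposition x (φ, W), ← norm_sq_superposition y (φ, W)]
      exact mul_le_mul (prob_le_norm_sq _ _) (prob_le_norm_sq _ _) (h0 y) (sq_nonneg _)
  simp_rw [h]
  rw [integral_finsetSum _ fun j _ => hi j]
  simp_rw [integral_prob_mul_prob]
  have e1 : ∑ α, x α ^ 2 = ‖φ‖ ^ 2 := sum_sq_schmidtCoeff φ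
  have e2 : ∑ α, x α * y α = Real.sqrt (weight χ (φ, W₀)) := sum_S_mul_truncCoeff χ (φ, W₀)
  rw [e1, e2, sum_sq_truncCoeff, Real.sq_sqrt (weight_nonneg _ _), Finset.sum_const,
    Finset.card_univ, Fintype.card_prod, Fintype.card_fin, nsmul_eq_mul]
  push_cast
  field_simp
  rfl

/-- The largest coefficient is always kept, and if it vanished all of them would. -/
theorem weight_pos (hN : 0 < N) {χ : ℕ} (hχ : 1 ≤ χ) {ω : Sample N} (hω : ω.1 ≠ 0) :
    0 < weight χ ω := by
  refine lt_of_le_of_ne (weight_nonneg χ ω) fun h => hω ?_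
  have h0 : S ω ⟨0, hN⟩ = 0 := by
    have := (Finset.sum_eq_zero_iff_of_nonneg fun _ _ => sq_nonneg _).mp h.symm ⟨0, hN⟩
      (by simpa using show 0 < χ from hχ)
    simpa using this
  have h1 : ∀ α, S ω α = 0 := fun α =>
    le_antisymm ((schmidtCoeff_antitone ω.1 (Fin.mk_le_of_le_val (Nat.zero_le _))).trans_eq h0)
      (schmidtCoeff_nonneg _ _)
  have h2 := sum_sq_S ω
  simp only [h1] at h2
  simpa using h2.symm

/-- The bias of the linear XEB, averaged over the Schmidt vectors only, is controlled by the largest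
Schmidt coefficient. -/
theorem abs_integral_linearXEB_sub_fidelity_le (hN : 0 < N) {χ : ℕ} (hχ : 1 ≤ χ) {φ : State N}
    (hφ : ‖φ‖ = 1) :
    |∫ W, (linearXEB χ (φ, W) - fidelity χ (φ, W)) ∂((haarUnitary N).prod (haarUnitary N))| ≤
      4 / N + 2 * schmidtCoeff φ ⟨0, hN⟩ ^ 2 := by
  have hN' : (0 : ℝ) < N := by exact_mod_cast hN
  have hint := integrable_overlap_section χ φ
  let W₀ : Matrix.unitaryGroup (Fin N) ℂ × Matrix.unitaryGroup (Fin N) ℂ := 1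
  set F := weight χ (φ, W₀) with hF
  have hfid : ∀ W, fidelity χ (φ, W) = F := fun W => fidelity_eq_weight χ (φ, W)
  have hFpos : 0 < F := weight_pos hN hχ fun h => by simp [show φ = 0 from h] at hφ
  have hF1 : F ≤ 1 := (weight_le χ (φ, W₀)).trans (by simp [hφ])
  set Q := ∑ α, schmidtCoeff φ α ^ 2 * truncCoeff χ (φ, W₀) α ^ 2 with hQ
  have hQ0 : 0 ≤ Q := Finset.sum_nonneg fun _ _ => mul_nonneg (sq_nonneg _) (sq_nonneg _)
  have hQ1 : Q ≤ schmidtCoeff φ ⟨0, hN⟩ ^ 2 := by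
    calc Q ≤ ∑ α, schmidtCoeff φ ⟨0, hN⟩ ^ 2 * truncCoeff χ (φ, W₀) α ^ 2 := by
          refine Finset.sum_le_sum fun α _ => mul_le_mul_of_nonneg_right ?_ (sq_nonneg _)
          exact pow_le_pow_left₀ (schmidtCoeff_nonneg _ _)
            (schmidtCoeff_antitone φ (Fin.mk_le_of_le_val (Nat.zero_le _))) 2
      _ ≤ schmidtCoeff φ ⟨0, hN⟩ ^ 2 := by
          rw [← Finset.mul_sum]
          exact mul_le_of_le_one_right (sq_nonneg _) (sum_sq_truncCoeff_le_one _ _)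
  have hval : ∫ W, (linearXEB χ (φ, W) - fidelity χ (φ, W)) ∂((haarUnitary N).prod (haarUnitary N)) =
      (N / (N + 1)) ^ 2 * (1 + F + 2 * Q) - 1 - F := by
    have hsub : Integrable (fun W => dim N * overlap χ (φ, W) - 1)
        ((haarUnitary N).prod (haarUnitary N)) := (hint.const_mul _).sub (integrable_const _)
    simp_rw [linearXEB, hfid]
    rw [integral_sub hsub (integrable_const _),
      integral_sub (hint.const_mul _) (integrable_const _), integral_const_mul,
      integral_overlap_section hN χ φ W₀, ← hF, inv_mul_cancel₀ hFpos.ne', hφ]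
    simp only [integral_const, probReal_univ, one_smul, dim]
    rw [div_pow]
    ring
  rw [hval]
  set r : ℝ := (N / (N + 1)) ^ 2 with hr
  have hr1 : r ≤ 1 := pow_le_one₀ (by positivity) ((div_le_one (by positivity)).mpr (by linarith))
  have hr0 : 0 ≤ r := sq_nonneg _
  have hr2 : 1 - r ≤ 2 / N := by
    rw [hr, div_pow, one_sub_div (by positivity), div_le_div_iff₀ (by positivity) hN']
    nlinarith
  -- The bias equals `2rQ - (1 - r)(1 + F)`, with `1 - r ≤ 2/N` and `1 + F ≤ 2`.
  have h4 : 4 / (N : ℝ) = 2 * (2 / N) := by ring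
  rw [abs_le, h4]
  constructor <;> nlinarith [mul_nonneg hr0 hQ0, mul_le_mul_of_nonneg_right hr1 hQ0,
    mul_nonneg (sub_nonneg.mpr hr1) (sub_nonneg.mpr hF1), mul_nonneg (sub_nonneg.mpr hr1) hFpos.le]

theorem integral_abs_bias_le (hN : 0 < N) {χ : ℕ} (hχ : 1 ≤ χ) :
    ∫ φ, |∫ W, (linearXEB χ (φ, W) - fidelity χ (φ, W)) ∂((haarUnitary N).prod (haarUnitary N))|
      ∂(haarState N) ≤ 1824 / N := by
  calc _ ≤ ∫ φ, (4 / N + 2 * schmidtCoeff φ ⟨0, hN⟩ ^ 2) ∂(haarState N) := by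
        -- Only the upper bound has to be integrable; the absolute bias needs no separate
        -- measurability argument.
        refine integral_mono_of_nonneg (Filter.Eventually.of_forall fun φ => abs_nonneg _)
          ((integrable_const _).add ((integrable_sq_schmidtCoeff _).const_mul _)) ?_
        filter_upwards [ae_norm_eq_one_haarState hN] with φ hφ
        exact abs_integral_linearXEB_sub_fidelity_le hN hχ hφ
    _ = 4 / N + 2 * ∫ φ, schmidtCoeff φ ⟨0, hN⟩ ^ 2 ∂(haarState N) := by
        rw [integral_add (integrable_const _) ((integrable_sq_schmidtCoeff _).const_mul _),
          integral_const_mul]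
        simp
    _ ≤ 4 / N + 2 * (910 / N) := by
        linarith [integral_sq_schmidtCoeff_zero_le hN]
    _ = 1824 / N := by ring

end XEB

end

theorem mainTheorem1 :
    ∃ C : ℝ, ∀ N χ : ℕ, 1 ≤ N → 1 ≤ χ →
      Integrable (fun ω : XEB.Sample N => XEB.overlap χ ω) (XEB.model N) ∧
      Integrable (fun ω : XEB.Sample N => XEB.fidelity χ ω) (XEB.model N) ∧
      |(XEB.dim N * (∫ ω : XEB.Sample N, XEB.overlap χ ω ∂(XEB.model N)) - 1) -
          ∫ ω : XEB.Sample N, XEB.fidelity χ ω ∂(XEB.model N)| ≤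
        C / Real.sqrt (XEB.dim N) ∧
      (∫ φ : XEB.State N,
          |∫ W : Matrix.unitaryGroup (Fin N) ℂ × Matrix.unitaryGroup (Fin N) ℂ,
              (XEB.linearXEB χ (φ, W) - XEB.fidelity χ (φ, W))
              ∂((XEB.haarUnitary N).prod (XEB.haarUnitary N))|
          ∂(XEB.haarState N)) ≤ C / Real.sqrt (XEB.dim N) := by
  refine ⟨1824, fun N χ hN hχ => ?_⟩
  have hov := XEB.integrable_overlap (N := N) χ
  have hfid := XEB.integrable_fidelity (N := N) χ
  have hsqrt : Real.sqrt (XEB.dim N) = N := Real.sqrt_sq (Nat.cast_nonneg N)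
  have hbias := XEB.integral_abs_bias_le hN hχ
  rw [hsqrt]
  refine ⟨hov, hfid, ?_, hbias⟩
  have hlin : Integrable (fun ω => XEB.linearXEB χ ω) (XEB.model N) :=
    (hov.const_mul _).sub (integrable_const 1)
  have hsub : Integrable (fun ω => XEB.linearXEB χ ω - XEB.fidelity χ ω) (XEB.model N) :=
    hlin.sub hfid
  have heq : (XEB.dim N * (∫ ω, XEB.overlap χ ω ∂(XEB.model N)) - 1) -
      ∫ ω, XEB.fidelity χ ω ∂(XEB.model N) =
      ∫ ω, (XEB.linearXEB χ ω - XEB.fidelity χ ω) ∂(XEB.model N) := by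
    rw [integral_sub hlin hfid]
    simp_rw [XEB.linearXEB]
    rw [integral_sub (hov.const_mul _) (integrable_const 1), integral_const_mul]
    simp
  -- By Fubini the fully averaged bias is the mean of the conditional bias, so the first estimate
  -- follows from the second.
  rw [heq, XEB.model, integral_prod _ hsub]
  exact (abs_integral_le_integral_abs).trans hbias
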